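/- Let $S$ be the monoid generated by $x_1,x_2,x_3,x_4$ subject to the relations $$x_4x_3=x_1x_4,\quad x_4x_2=x_2x_4,\quad x_4x_1=x_3x_4,\quad x_3x_2=x_1x_3,\quad x_3x_1=x_2x_3,\quad x_2x_1=x_1x_2,$$ let $K$ be a field and let $K[S]$ be the monoid algebra. Let $\rho$ be the least cancellative congruence on $S$, that is, the intersection of all congruences $\sim$ on $S$ such that $S/{\sim}$ is cancellative, and let $I(\rho)$ be the kernel of the natural homomorphism $K[S]\to K[S/\rho]$. For elements $a_1,\dots,a_k$ of $K[S]$, write $(a_1,\dots,a_k)$ for the two-sided ideal of $K[S]$ that they generate. Then the minimal prime ideals of $K[S]$ are exactly $$P_1=(x_1-x_2,\;x_2-x_3),\quad P_2=(x_4),\quad P_3=(x_1,x_3),\quad P_4=(x_2),$$ and $P_1=I(\rho)$. Moreover, $K[S]$ is semiprime, its classical Krull dimension (the supremum of the lengths of chains of prime ideals) is $3$, and $$S=\langle x_1,x_2,x_3\rangle\cup\langle x_1\rangle\langle x_4\rangle\cup\langle x_2\rangle\langle x_4\rangle\cup\langle x_3\rangle\langle x_4\rangle\cup\langle x_1\rangle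 x_2\langle x_4\rangle,$$ where $\langle Z\rangle$ denotes the submonoid of $S$ generated by $Z$. -/

import Mathlib

open scoped Pointwise

/-! ### Noncommutative primes, semiprimeness, classical Krull dimension -/

/-- A two-sided ideal `P` of a (not necessarily commutative) ring `R` is prime if `P ≠ R` and
`a R b ⊆ P` implies `a ∈ P` or `b ∈ P`. -/
def IsPrimeTwoSided {R : Type*} [Ring R] (P : TwoSidedIdeal R) : Prop :=
  P ≠ ⊤ ∧ ∀ a b : R, (∀ r : R, a * r * b ∈ P) → a ∈ P ∨ b ∈ P

/-- The set of minimal primes of `R`. -/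
def minimalPrimesTwoSided (R : Type*) [Ring R] : Set (TwoSidedIdeal R) :=
  {P | Minimal IsPrimeTwoSided P}

/-- `R` is semiprime if `a R a = 0` implies `a = 0`. -/
def IsSemiprimeRing (R : Type*) [Ring R] : Prop :=
  ∀ a : R, (∀ r : R, a * r * a = 0) → a = 0

/-- The classical Krull dimension: the supremum of the lengths of chains of prime ideals. -/
noncomputable def classicalKrullDim (R : Type*) [Ring R] : WithBot ℕ∞ :=
  Order.krullDim {P : TwoSidedIdeal R // IsPrimeTwoSided P}

/-! ### The least cancellative congruence and its ideal -/

/-- The least cancellative congruence on a monoid `S`: the intersection of all congruences `c`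
such that `S / c` is cancellative. -/
def leastCancelCon (S : Type*) [Monoid S] : Con S :=
  sInf {c : Con S | IsCancelMul c.Quotient}

/-- The ideal `I(c)` of `K[S]` determined by a congruence `c` on `S`: the kernel of the natural
homomorphism `K[S] → K[S / c]`. -/
noncomputable def conIdeal (K : Type*) [Field K] {S : Type*} [Monoid S] (c : Con S) :
    TwoSidedIdeal (MonoidAlgebra K S) :=
  TwoSidedIdeal.ker (MonoidAlgebra.mapDomainRingHom K c.mk')

/-! ### The monoid of the example -/

namespace SkewExample

/-- The four generators. -/
inductive Gen : Type
  | x₁ | x₂ | x₃ | x₄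

open Gen FreeMonoid in
/-- The six defining relations. -/
inductive Rel : FreeMonoid Gen → FreeMonoid Gen → Prop
  | r43 : Rel (of x₄ * of x₃) (of x₁ * of x₄)
  | r42 : Rel (of x₄ * of x₂) (of x₂ * of x₄)
  | r41 : Rel (of x₄ * of x₁) (of x₃ * of x₄)
  | r32 : Rel (of x₃ * of x₂) (of x₁ * of x₃)
  | r31 : Rel (of x₃ * of x₁) (of x₂ * of x₃)
  | r21 : Rel (of x₂ * of x₁) (of x₁ * of x₂)

/-- The monoid `S` generated by `x₁, x₂, x₃, x₄` subject to the six relations. -/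
abbrev S : Type := PresentedMonoid Rel

/-- The generator `x₁` of `S`. -/
def x₁ : S := PresentedMonoid.of Rel Gen.x₁
/-- The generator `x₂` of `S`. -/
def x₂ : S := PresentedMonoid.of Rel Gen.x₂
/-- The generator `x₃` of `S`. -/
def x₃ : S := PresentedMonoid.of Rel Gen.x₃
/-- The generator `x₄` of `S`. -/
def x₄ : S := PresentedMonoid.of Rel Gen.x₄

/-- An element of `S`, viewed in `K[S]`. -/
noncomputable def emb (K : Type*) [Field K] (s : S) : MonoidAlgebra K S :=
  MonoidAlgebra.of K S s

/-- The ideal `P₁ = (x₁ - x₂, x₂ - x₃)` of `K[S]`. -/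
noncomputable def P₁ (K : Type*) [Field K] : TwoSidedIdeal (MonoidAlgebra K S) :=
  TwoSidedIdeal.span {emb K x₁ - emb K x₂, emb K x₂ - emb K x₃}

/-- The ideal `P₂ = (x₄)` of `K[S]`. -/
noncomputable def P₂ (K : Type*) [Field K] : TwoSidedIdeal (MonoidAlgebra K S) :=
  TwoSidedIdeal.span {emb K x₄}

/-- The ideal `P₃ = (x₁, x₃)` of `K[S]`. -/
noncomputable def P₃ (K : Type*) [Field K] : TwoSidedIdeal (MonoidAlgebra K S) :=
  TwoSidedIdeal.span {emb K x₁, emb K x₃}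

/-- The ideal `P₄ = (x₂)` of `K[S]`. -/
noncomputable def P₄ (K : Type*) [Field K] : TwoSidedIdeal (MonoidAlgebra K S) :=
  TwoSidedIdeal.span {emb K x₂}

end SkewExample

/-! ### Consequences of the relations and normal forms in `S`. -/

namespace SkewExample

/-! The overlaps x₄x₃x₁ and x₄x₂x₁ of the defining relations force x₁x₃x₄ = x₂x₃x₄ = x₁x₂x₄. Hence a
word in x₁, x₂, x₃ that is not a power of one letter depends only on its length once x₄ follows it
(`ordered_mul_x₄`), which gives the list in `normal_form`.

Each Pᵢ is the kernel of an explicit map to a polynomial ring or to 2×2 matrices over one: normal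
forms modulo Pᵢ have independent coordinates (`mem_of_map_eq_zero`), and in the matrix cases the
image spans multiples of all matrix units, so the kernel is prime. Peeling off families of normal
forms shows that the four ideals intersect in 0 (`eq_zero_of_mem`), whence semiprimeness.

Modulo a prime without x₄, the letter x₄ can be cancelled. Then x₁ - x₂ and x₂ - x₃ annihilate the
central element x₁x₂, so the prime contains P₁ or x₁x₂, and in the latter case P₃ or P₄
(`exists_le_of_isPrime`). The same equalities identify x₁, x₂, x₃ in every cancellative quotient,
which gives P₁ = I(ρ).

For the dimension, K[S] is finite over the image of a polynomial ring in four variables, sent to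
central elements. Contraction of primes is strictly monotone (`primeContraction_lt`), and
`zeta_relation` keeps every contraction away from 0, so chains have length at most 4 - 1. A chain
starting at P₂ attains 3. -/

theorem x₄_mul_x₃ : x₄ * x₃ = x₁ * x₄ := PresentedMonoid.mk_eq_mk_of_rel Rel.r43
theorem x₄_mul_x₂ : x₄ * x₂ = x₂ * x₄ := PresentedMonoid.mk_eq_mk_of_rel Rel.r42
theorem x₄_mul_x₁ : x₄ * x₁ = x₃ * x₄ := PresentedMonoid.mk_eq_mk_of_rel Rel.r41
theorem x₃_mul_x₂ : x₃ * x₂ = x₁ * x₃ := PresentedMonoid.mk_eq_mk_of_rel Rel.r32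
theorem x₃_mul_x₁ : x₃ * x₁ = x₂ * x₃ := PresentedMonoid.mk_eq_mk_of_rel Rel.r31
theorem x₂_mul_x₁ : x₂ * x₁ = x₁ * x₂ := PresentedMonoid.mk_eq_mk_of_rel Rel.r21

/-- The two ways of reducing the overlap x₄x₃x₁. -/
theorem x₁_mul_x₃_mul_x₄ : x₁ * x₃ * x₄ = x₁ * x₂ * x₄ := by
  calc x₁ * x₃ * x₄ = x₁ * (x₄ * x₁) := by rw [x₄_mul_x₁, mul_assoc]
    _ = x₄ * (x₃ * x₁) := by rw [← mul_assoc, ← mul_assoc, x₄_mul_x₃]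
    _ = x₄ * x₂ * x₃ := by rw [x₃_mul_x₁, mul_assoc]
    _ = x₂ * x₁ * x₄ := by rw [x₄_mul_x₂, mul_assoc, x₄_mul_x₃, mul_assoc]
    _ = _ := by rw [x₂_mul_x₁]

/-- The two ways of reducing the overlap x₄x₂x₁. -/
theorem x₂_mul_x₃_mul_x₄ : x₂ * x₃ * x₄ = x₁ * x₂ * x₄ := by
  calc x₂ * x₃ * x₄ = x₂ * (x₄ * x₁) := by rw [x₄_mul_x₁, mul_assoc]
    _ = x₄ * (x₂ * x₁) := by rw [← mul_assoc, ← mul_assoc, x₄_mul_x₂]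
    _ = x₄ * x₁ * x₂ := by rw [x₂_mul_x₁, mul_assoc]
    _ = x₃ * x₂ * x₄ := by rw [x₄_mul_x₁, mul_assoc, x₄_mul_x₂, mul_assoc]
    _ = _ := by rw [x₃_mul_x₂, x₁_mul_x₃_mul_x₄]

/-- Induction on elements of `S`, adding generators on the right. -/
theorem right_induction {p : S → Prop} (s : S) (one : p 1)
    (h₁ : ∀ s, p s → p (s * x₁)) (h₂ : ∀ s, p s → p (s * x₂))
    (h₃ : ∀ s, p s → p (s * x₃)) (h₄ : ∀ s, p s → p (s * x₄)) : p s := by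
  have hs : s ∈ Submonoid.closure (Set.range (PresentedMonoid.of Rel)) := by
    rw [PresentedMonoid.closure_range_of]; trivial
  induction hs using Submonoid.closure_induction_right with
  | one => exact one
  | mul_right x _ y hy ih =>
    obtain ⟨g, rfl⟩ := hy
    cases g
    exacts [h₁ x ih, h₂ x ih, h₃ x ih, h₄ x ih]

/-- Induction on elements of `S`, adding generators on the left. -/
theorem left_induction {p : S → Prop} (s : S) (one : p 1)
    (h₁ : ∀ s, p s → p (x₁ * s)) (h₂ : ∀ s, p s → p (x₂ * s))
    (h₃ : ∀ s, p s → p (x₃ * s)) (h₄ : ∀ s, p s → p (x₄ * s)) : p s := by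
  have hs : s ∈ Submonoid.closure (Set.range (PresentedMonoid.of Rel)) := by
    rw [PresentedMonoid.closure_range_of]; trivial
  induction hs using Submonoid.closure_induction_left with
  | one => exact one
  | mul_left y hy x _ ih =>
    obtain ⟨g, rfl⟩ := hy
    cases g
    exacts [h₁ x ih, h₂ x ih, h₃ x ih, h₄ x ih]

theorem x₃_mul_x₁_pow (n : ℕ) : x₃ * x₁ ^ n = x₂ ^ n * x₃ := (show SemiconjBy x₃ x₁ x₂ from x₃_mul_x₁).pow_right n
theorem commute_x₂_x₁ : Commute x₂ x₁ := x₂_mul_x₁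

/-- The ordered words are closed under right multiplication by `x₁`, `x₂`, `x₃`. -/
theorem ordered_mul (a b c : ℕ) :
    (∃ a' b' c', x₁ ^ a * x₂ ^ b * x₃ ^ c * x₁ = x₁ ^ a' * x₂ ^ b' * x₃ ^ c') ∧
    (∃ a' b' c', x₁ ^ a * x₂ ^ b * x₃ ^ c * x₂ = x₁ ^ a' * x₂ ^ b' * x₃ ^ c') := by
  induction c with
  | zero =>
    refine ⟨⟨a + 1, b, 0, ?_⟩, a, b + 1, 0, ?_⟩
    · rw [pow_zero, mul_one, mul_one, mul_assoc, (commute_x₂_x₁.pow_left b).eq, ← mul_assoc, pow_succ]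
    · rw [pow_zero, mul_one, mul_one, mul_assoc, pow_succ]
  | succ c ih =>
    obtain ⟨⟨a₁, b₁, c₁, h₁⟩, a₂, b₂, c₂, h₂⟩ := ih
    -- Moving past x₃ exchanges x₁ and x₂, so each half uses the induction hypothesis of the other.
    refine ⟨⟨a₂, b₂, c₂ + 1, ?_⟩, a₁, b₁, c₁ + 1, ?_⟩
    · rw [pow_succ x₃ c, pow_succ x₃ c₂, ← mul_assoc, mul_assoc _ x₃, x₃_mul_x₁, ← mul_assoc, h₂, mul_assoc]
    · rw [pow_succ x₃ c, pow_succ x₃ c₁, ← mul_assoc, mul_assoc _ x₃, x₃_mul_x₂, ← mul_assoc, h₁, mul_assoc]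

/-- Pushing a generator through a power of `x₄`. -/
theorem x₄_pow_mul (d : ℕ) :
    (x₄ ^ d * x₁ = x₁ * x₄ ^ d ∧ x₄ ^ d * x₃ = x₃ * x₄ ^ d) ∨
    (x₄ ^ d * x₁ = x₃ * x₄ ^ d ∧ x₄ ^ d * x₃ = x₁ * x₄ ^ d) := by
  -- The two alternatives correspond to even and odd `d`.
  induction d with
  | zero => left; simp
  | succ d ih =>
    rcases ih with ⟨h, h'⟩ | ⟨h, h'⟩
    · right; constructor
      · rw [pow_succ', mul_assoc, h, ← mul_assoc, x₄_mul_x₁, mul_assoc]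
      · rw [pow_succ', mul_assoc, h', ← mul_assoc, x₄_mul_x₃, mul_assoc]
    · left; constructor
      · rw [pow_succ', mul_assoc, h, ← mul_assoc, x₄_mul_x₃, mul_assoc]
      · rw [pow_succ', mul_assoc, h', ← mul_assoc, x₄_mul_x₁, mul_assoc]

theorem exists_ordered (s : S) : ∃ a b c d, s = x₁ ^ a * x₂ ^ b * x₃ ^ c * x₄ ^ d := by
  have g1 : ∀ a b c d, ∃ a' b' c', x₁ ^ a * x₂ ^ b * x₃ ^ c * (x₁ * x₄ ^ d) =
      x₁ ^ a' * x₂ ^ b' * x₃ ^ c' * x₄ ^ d := fun a b c d ↦ by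
    obtain ⟨a', b', c', h⟩ := (ordered_mul a b c).1
    exact ⟨a', b', c', by rw [← mul_assoc, h]⟩
  have g3 : ∀ a b c d, ∃ a' b' c', x₁ ^ a * x₂ ^ b * x₃ ^ c * (x₃ * x₄ ^ d) =
      x₁ ^ a' * x₂ ^ b' * x₃ ^ c' * x₄ ^ d := fun a b c d ↦
    ⟨a, b, c + 1, by rw [pow_succ]; simp only [mul_assoc]⟩
  induction s using right_induction with
  | one => exact ⟨0, 0, 0, 0, by simp⟩
  | h₁ s ih =>
    obtain ⟨a, b, c, d, rfl⟩ := ih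
    rw [mul_assoc]
    rcases x₄_pow_mul d with ⟨h, -⟩ | ⟨h, -⟩ <;> rw [h]
    · obtain ⟨a', b', c', h⟩ := g1 a b c d; exact ⟨a', b', c', d, h⟩
    · obtain ⟨a', b', c', h⟩ := g3 a b c d; exact ⟨a', b', c', d, h⟩
  | h₂ s ih =>
    obtain ⟨a, b, c, d, rfl⟩ := ih
    obtain ⟨a', b', c', h⟩ := (ordered_mul a b c).2
    refine ⟨a', b', c', d, ?_⟩
    rw [mul_assoc, ((show Commute x₄ x₂ from x₄_mul_x₂).pow_left d).eq, ← mul_assoc, h]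
  | h₃ s ih =>
    obtain ⟨a, b, c, d, rfl⟩ := ih
    rw [mul_assoc]
    rcases x₄_pow_mul d with ⟨-, h⟩ | ⟨-, h⟩ <;> rw [h]
    · obtain ⟨a', b', c', h⟩ := g3 a b c d; exact ⟨a', b', c', d, h⟩
    · obtain ⟨a', b', c', h⟩ := g1 a b c d; exact ⟨a', b', c', d, h⟩
  | h₄ s ih =>
    obtain ⟨a, b, c, d, rfl⟩ := ih
    exact ⟨a, b, c, d + 1, by rw [pow_succ, mul_assoc]⟩

/-- The word `x₁ᵏ⁺¹ x₂ x₄`, the normal form of all words in `x₁, x₂, x₃` of length `k + 2`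
followed by `x₄` that are not the power of a single generator. -/
def mixed (k : ℕ) : S := x₁ ^ (k + 1) * x₂ * x₄

theorem x₁_mul_mixed (k : ℕ) : x₁ * mixed k = mixed (k + 1) := by
  rw [mixed, mixed, pow_succ' _ (k + 1)]; simp only [mul_assoc]

theorem mixed_eq (k : ℕ) : mixed k = x₁ ^ k * mixed 0 := by
  simp only [mixed, zero_add, pow_zero, one_mul, pow_succ, mul_assoc]

theorem x₂_mul_mixed_zero : x₂ * mixed 0 = mixed 1 := by
  have h : mixed 0 = x₁ * x₃ * x₄ := by rw [x₁_mul_x₃_mul_x₄, mixed, zero_add, pow_one]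
  rw [h, ← x₁_mul_mixed, mixed, zero_add, pow_one, ← x₂_mul_x₃_mul_x₄]
  simp only [← mul_assoc, x₂_mul_x₁]

theorem x₂_mul_mixed (k : ℕ) : x₂ * mixed k = mixed (k + 1) := by
  rw [mixed_eq, ← mul_assoc, (commute_x₂_x₁.pow_right k).eq, mul_assoc, x₂_mul_mixed_zero,
    mixed_eq 1, mixed_eq (k + 1), pow_one, pow_succ, mul_assoc]

theorem x₂_pow_mul_mixed (n k : ℕ) : x₂ ^ n * mixed k = mixed (n + k) := by
  induction n with
  | zero => simp
  | succ n ih => rw [pow_succ', mul_assoc, ih, x₂_mul_mixed]; congr 1; omega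

theorem x₁_pow_mul_mixed (n k : ℕ) : x₁ ^ n * mixed k = mixed (n + k) := by
  induction n with
  | zero => simp
  | succ n ih => rw [pow_succ', mul_assoc, ih, x₁_mul_mixed]; congr 1; omega

theorem x₃_mul_mixed_zero : x₃ * mixed 0 = mixed 1 := by
  rw [mixed, zero_add, pow_one, ← mul_assoc, ← mul_assoc, x₃_mul_x₁, mul_assoc x₂, x₃_mul_x₂,
    ← mul_assoc, x₂_mul_x₁, mul_assoc x₁, mul_assoc x₁, x₂_mul_x₃_mul_x₄, ← x₁_mul_mixed]
  simp [mixed]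

theorem x₃_mul_mixed (k : ℕ) : x₃ * mixed k = mixed (k + 1) := by
  rw [mixed_eq, ← mul_assoc, x₃_mul_x₁_pow, mul_assoc, x₃_mul_mixed_zero, x₂_pow_mul_mixed]

/-- Since x₁x₃ = x₃x₂ and x₂x₃ = x₃x₁, one factor x₃ moves to the front and exchanges the two
claims, so they are proved together. -/
theorem x₃_pow_mul_x₄ (c : ℕ) : x₁ * x₃ ^ (c + 1) * x₄ = mixed c ∧ x₂ * x₃ ^ (c + 1) * x₄ = mixed c := by
  induction c with
  | zero => simp [mixed, x₁_mul_x₃_mul_x₄, x₂_mul_x₃_mul_x₄]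
  | succ c ih =>
    constructor
    · rw [pow_succ', ← mul_assoc, ← x₃_mul_x₂, mul_assoc, mul_assoc, ← mul_assoc x₂, ih.2, x₃_mul_mixed]
    · rw [pow_succ', ← mul_assoc, ← x₃_mul_x₁, mul_assoc, mul_assoc, ← mul_assoc x₁, ih.1, x₃_mul_mixed]

theorem x₁_mul_x₂_pow_mul_x₄ (b : ℕ) : x₁ * x₂ ^ (b + 1) * x₄ = mixed b := by
  rw [pow_succ, ← mul_assoc, ← (commute_x₂_x₁.pow_left b).eq, mul_assoc, mul_assoc]
  have : x₁ * (x₂ * x₄) = mixed 0 := by simp [mixed, mul_assoc]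
  rw [this, x₂_pow_mul_mixed, add_zero]

/-- Normal forms of the words `w x₄` with `w` a word in `x₁, x₂, x₃`. -/
theorem ordered_mul_x₄ (a b c : ℕ) :
    (b = 0 ∧ c = 0) ∨ (a = 0 ∧ c = 0) ∨ (a = 0 ∧ b = 0) ∨
      x₁ ^ a * x₂ ^ b * x₃ ^ c * x₄ = mixed (a + b + c - 2) := by
  -- Wherever the last alternative is proved, two exponents are positive, so the subtraction of 2 is
  -- not truncated.
  rcases c with - | c
  · rcases a with - | a
    · simp
    rcases b with - | b
    · simp
    right; right; right
    rw [pow_zero, mul_one, pow_succ, mul_assoc, mul_assoc, ← mul_assoc x₁, x₁_mul_x₂_pow_mul_x₄,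
      x₁_pow_mul_mixed]
    congr 1; omega
  · rcases b with - | b
    · rcases a with - | a
      · simp
      right; right; right
      rw [pow_zero, mul_one, pow_succ, mul_assoc, mul_assoc, ← mul_assoc x₁, (x₃_pow_mul_x₄ c).1,
        x₁_pow_mul_mixed]
      congr 1; omega
    · right; right; right
      rw [pow_succ x₂, mul_assoc, mul_assoc, mul_assoc, ← mul_assoc x₂, (x₃_pow_mul_x₄ c).2,
        x₂_pow_mul_mixed, x₁_pow_mul_mixed]
      congr 1; omega

/-- Every element of `S` has one of the listed forms. -/
theorem normal_form (s : S) : (∃ a b c, s = x₁ ^ a * x₂ ^ b * x₃ ^ c) ∨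
    (∃ b d, s = x₂ ^ b * x₄ ^ (d + 1)) ∨ (∃ a d, s = x₁ ^ (a + 1) * x₄ ^ (d + 1)) ∨
    (∃ c d, s = x₃ ^ (c + 1) * x₄ ^ (d + 1)) ∨ ∃ k d, s = mixed k * x₄ ^ d := by
  obtain ⟨a, b, c, d, rfl⟩ := exists_ordered s
  rcases d with - | d
  · exact .inl ⟨a, b, c, by simp⟩
  right
  rcases ordered_mul_x₄ a b c with ⟨rfl, rfl⟩ | ⟨rfl, rfl⟩ | ⟨rfl, rfl⟩ | h
  · rcases a with - | a
    · exact .inl ⟨0, d, by simp⟩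
    · exact .inr (.inl ⟨a, d, by simp⟩)
  · exact .inl ⟨b, d, by simp⟩
  · rcases c with - | c
    · exact .inl ⟨0, d, by simp⟩
    · exact .inr (.inr (.inl ⟨c, d, by simp⟩))
  · exact .inr (.inr (.inr ⟨_, d, by rw [pow_succ', ← mul_assoc, h]⟩))

theorem univ_eq_union : (Set.univ : Set S) =
    (Submonoid.closure {x₁, x₂, x₃} : Set S) ∪
    (Submonoid.powers x₁ : Set S) * Submonoid.powers x₄ ∪
    (Submonoid.powers x₂ : Set S) * Submonoid.powers x₄ ∪
    (Submonoid.powers x₃ : Set S) * Submonoid.powers x₄ ∪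
    (Submonoid.powers x₁ : Set S) * {x₂} * Submonoid.powers x₄ := by
  refine (Set.eq_univ_of_forall fun s ↦ ?_).symm
  rcases normal_form s with ⟨a, b, c, rfl⟩ | ⟨b, d, rfl⟩ | ⟨a, d, rfl⟩ | ⟨c, d, rfl⟩ | ⟨k, d, rfl⟩
  · refine .inl (.inl (.inl (.inl ?_)))
    have h : ∀ x ∈ ({x₁, x₂, x₃} : Set S), ∀ n : ℕ, x ^ n ∈ Submonoid.closure {x₁, x₂, x₃} :=
      fun x hx n ↦ pow_mem (Submonoid.subset_closure hx) n
    exact mul_mem (mul_mem (h _ (by simp) _) (h _ (by simp) _)) (h _ (by simp) _)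
  · exact .inl (.inl (.inr (Set.mul_mem_mul ⟨_, rfl⟩ ⟨_, rfl⟩)))
  · exact .inl (.inl (.inl (.inr (Set.mul_mem_mul ⟨_, rfl⟩ ⟨_, rfl⟩))))
  · exact .inl (.inr (Set.mul_mem_mul ⟨_, rfl⟩ ⟨_, rfl⟩))
  · refine .inr ⟨_, Set.mul_mem_mul ⟨k + 1, rfl⟩ rfl, _, ⟨d + 1, rfl⟩, ?_⟩
    simp only [mixed, pow_succ', mul_assoc]

end SkewExample

/-! ### Primes of algebras that are finite over a central subring. -/

open scoped TensorProduct nonZeroDivisors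

/-- A left ideal of a prime artinian ring that contains `qC` for some `q ≠ 0` is the whole ring. -/
theorem eq_top_of_prime_of_isArtinianRing {C : Type*} [Ring C] [IsArtinianRing C]
    (hC : ∀ a b : C, (∀ r, a * r * b = 0) → a = 0 ∨ b = 0)
    (Q : Ideal C) (q : C) (hq : q ≠ 0) (hqQ : ∀ c, q * c ∈ Q) : Q = ⊤ := by
  -- Primeness keeps all powers of a nonzero left ideal nonzero, while the radical of an artinian
  -- ring is nilpotent.
  have hJ : Ring.jacobson C = ⊥ := by
    by_contra hJ
    obtain ⟨x, hx, hx0⟩ := (Submodule.ne_bot_iff _).1 hJ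
    have h : ∀ n : ℕ, Ring.jacobson C ^ n ≠ ⊥ := by
      intro n
      induction n with
      | zero =>
        intro h0
        have : (1 : C) ∈ (⊥ : Ideal C) := by rw [← h0, Submodule.pow_zero, Ideal.one_eq_top]; trivial
        exact hx0 (by rw [← mul_one x, (Submodule.mem_bot C).1 this, mul_zero])
      | succ n ih =>
        intro h0
        obtain ⟨y, hy, hy0⟩ := (Submodule.ne_bot_iff _).1 ih
        refine (hC y x fun r ↦ ?_).elim hy0 hx0
        have : y * (r * x) ∈ Ring.jacobson C ^ (n + 1) := by
          rw [Submodule.pow_succ]; exact Ideal.mul_mem_mul hy (Ideal.mul_mem_left _ r hx)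
        rw [h0] at this
        rw [mul_assoc]; exact (Submodule.mem_bot C).1 this
    obtain ⟨n, hn⟩ := IsArtinianRing.isNilpotent_jacobson_bot (R := C)
    rw [Ideal.jacobson_bot] at hn
    exact h n hn
  have : IsSemisimpleRing C := IsArtinianRing.isSemisimpleRing_iff_jacobson.2 hJ
  -- By semisimplicity `Q` has a complement `L`. Then qCL lies in Q ∩ L = 0, so primeness gives L =
  -- 0.
  obtain ⟨L, hL⟩ := exists_isCompl Q
  have : L = ⊥ := by
    rw [eq_bot_iff]
    intro x hx
    refine (hC q x fun r ↦ ?_).resolve_left hq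
    have := hL.disjoint
    rw [Submodule.disjoint_def] at this
    exact this _ (by rw [mul_assoc]; exact hqQ _) (Ideal.mul_mem_left _ _ hx)
  rw [this] at hL
  simpa using hL.sup_eq_top

/-- A nonzero ideal in a prime ring which is a finite module over a central subdomain meets this
subdomain. -/
theorem exists_algebraMap_mem_of_injective {A R : Type*} [CommRing A] [IsDomain A] [Ring R]
    [Algebra A R] [Module.Finite A R] (hinj : Function.Injective (algebraMap A R))
    (hR : ∀ a b : R, (∀ r, a * r * b = 0) → a = 0 ∨ b = 0)
    (Q : TwoSidedIdeal R) {q : R} (hqQ : q ∈ Q) (hq : q ≠ 0) :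
    ∃ a : A, a ≠ 0 ∧ algebraMap A R a ∈ Q := by
  -- Inverting the nonzero elements of `A` makes `R` a finite-dimensional algebra over the fraction
  -- field, hence artinian. It stays prime, because every element has a denominator in `A`.
  let F := FractionRing A
  let C := F ⊗[A] R
  have : IsArtinianRing C := isArtinian_of_tower F (inferInstance : IsArtinian F C)
  let ι : R →ₐ[A] C := Algebra.TensorProduct.includeRight
  have hloc : IsLocalizedModule A⁰ (TensorProduct.mk A F R 1) := inferInstance
  have hsurj : ∀ y : C, ∃ (s : A) (r : R), s ≠ 0 ∧ s • y = ι r := fun y ↦ by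
    obtain ⟨⟨r, s⟩, h⟩ := IsLocalizedModule.surj A⁰ (TensorProduct.mk A F R 1) y
    exact ⟨s, r, nonZeroDivisors.ne_zero s.2, h⟩
  have htf : ∀ (s : A) (r : R), s ≠ 0 → s • r = 0 → r = 0 := fun s r hs h ↦ by
    refine (hR (algebraMap A R s) r fun t ↦ ?_).resolve_left ?_
    · rw [mul_assoc, ← Algebra.smul_def, ← mul_smul_comm, h, mul_zero]
    · exact (map_ne_zero_iff _ hinj).2 hs
  have hι : Function.Injective ι := by
    rw [injective_iff_map_eq_zero]
    intro r hr
    obtain ⟨s, hs⟩ := (IsLocalizedModule.eq_zero_iff A⁰ (TensorProduct.mk A F R 1)).1 hr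
    exact htf s r (nonZeroDivisors.ne_zero s.2) hs
  have hunit : ∀ (s : A) (y : C), s ≠ 0 → s • y = 0 → y = 0 := fun s y hs h ↦ by
    rw [← algebraMap_smul F s y, smul_eq_zero] at h
    exact h.resolve_left (by simpa using hs)
  -- The extension of `Q` to `C`, as the left ideal of fractions with numerator in `Q`. Once it
  -- contains 1, a denominator of 1 is the required element of `A`.
  let QC : Ideal C :=
    { carrier := {y | ∃ (s : A) (r : R), s ≠ 0 ∧ r ∈ Q ∧ s • y = ι r}
      zero_mem' := ⟨1, 0, one_ne_zero, Q.zero_mem, by simp⟩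
      add_mem' := by
        rintro y z ⟨s, r, hs, hr, h⟩ ⟨s', r', hs', hr', h'⟩
        refine ⟨s * s', algebraMap A R s' * r + algebraMap A R s * r', mul_ne_zero hs hs',
          Q.add_mem (Q.mul_mem_left _ _ hr) (Q.mul_mem_left _ _ hr'), ?_⟩
        rw [smul_add, map_add, ← Algebra.smul_def, ← Algebra.smul_def, map_smul, map_smul, ← h,
          ← h', smul_smul, smul_smul, mul_comm s']
      smul_mem' := by
        rintro c y ⟨s, r, hs, hr, h⟩
        obtain ⟨t, u, ht, hu⟩ := hsurj c
        refine ⟨t * s, u * r, mul_ne_zero ht hs, Q.mul_mem_left _ _ hr, ?_⟩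
        rw [map_mul, ← hu, ← h, smul_eq_mul, smul_mul_smul_comm] }
  have hQC : QC = ⊤ := by
    refine eq_top_of_prime_of_isArtinianRing ?_ QC (ι q) ?_ ?_
    · intro x y hxy
      obtain ⟨s, a, hs, ha⟩ := hsurj x
      obtain ⟨t, b, ht, hb⟩ := hsurj y
      have : a = 0 ∨ b = 0 := hR a b fun r ↦ hι <| by
        rw [map_mul, map_mul, ← ha, ← hb, smul_mul_assoc, smul_mul_smul_comm, hxy, smul_zero, map_zero]
      refine this.imp (fun h ↦ hunit s x hs ?_) fun h ↦ hunit t y ht ?_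
      · rw [ha, h, map_zero]
      · rw [hb, h, map_zero]
    · exact (map_ne_zero_iff _ hι).2 hq
    · intro c
      obtain ⟨t, u, ht, hu⟩ := hsurj c
      exact ⟨t, q * u, ht, Q.mul_mem_right _ _ hqQ, by rw [map_mul, ← hu, mul_smul_comm]⟩
  obtain ⟨s, r, hs, hr, h⟩ : (1 : C) ∈ QC := by rw [hQC]; trivial
  refine ⟨s, hs, ?_⟩
  convert hr
  apply hι
  rw [← h, AlgHom.commutes, Algebra.algebraMap_eq_smul_one]

/-- Contraction of primes of a finite algebra to a central subring. -/
def primeContraction (A : Type*) {R : Type*} [CommRing A] [Ring R] [Algebra A R]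
    (P : TwoSidedIdeal R) (hP : IsPrimeTwoSided P) : PrimeSpectrum A where
  asIdeal :=
    { carrier := {a | algebraMap A R a ∈ P}
      zero_mem' := by simp
      add_mem' := fun ha hb ↦ by simpa using P.add_mem ha hb
      smul_mem' := fun c a ha ↦ by simpa using P.mul_mem_left _ _ ha }
  isPrime :=
    { ne_top' := fun h ↦ hP.1 <| by
        have h1 : (1 : R) ∈ P := by
          rw [← map_one (algebraMap A R)]
          exact (Ideal.eq_top_iff_one _).1 h
        rw [eq_top_iff]
        intro x _
        rw [← mul_one x]
        exact P.mul_mem_left _ _ h1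
      mem_or_mem' := fun {a b} h ↦ hP.2 _ _ fun r ↦ by
        rw [mul_assoc, ← Algebra.commutes b, ← mul_assoc, ← map_mul]
        exact P.mul_mem_right _ _ h }

theorem mem_primeContraction {A R : Type*} [CommRing A] [Ring R] [Algebra A R]
    {P : TwoSidedIdeal R} {hP : IsPrimeTwoSided P} {a : A} :
    a ∈ (primeContraction A P hP).asIdeal ↔ algebraMap A R a ∈ P := Iff.rfl

/-- Incomparability for finite algebras over a central subring. -/
theorem primeContraction_lt {A R : Type*} [CommRing A] [Ring R] [Algebra A R] [Module.Finite A R]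
    {P Q : TwoSidedIdeal R} (hP : IsPrimeTwoSided P) (hQ : IsPrimeTwoSided Q) (hPQ : P < Q) :
    primeContraction A P hP < primeContraction A Q hQ := by
  refine lt_of_le_not_ge (fun a ha ↦ hPQ.le ha) fun hle ↦ ?_
  obtain ⟨q, hqQ, hqP⟩ := Set.exists_of_ssubset ((TwoSidedIdeal.lt_iff P Q).1 hPQ)
  let p := (primeContraction A P hP).asIdeal
  have : p.IsPrime := (primeContraction A P hP).isPrime
  -- The prime ring R/P is finite over the domain A/p, and Q/P is a nonzero ideal. It therefore
  -- contains the image of a nonzero element of A/p, against the assumption that `Q` contracts into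
  -- `p`.
  let π : R →+* P.ringCon.Quotient := P.ringCon.mk'
  have hπ : Function.Surjective π := P.ringCon.mk'_surjective
  have hker : ∀ x, π x = 0 ↔ x ∈ P := fun x ↦ by
    rw [← TwoSidedIdeal.mem_ker, TwoSidedIdeal.ker_ringCon_mk']
  let f : A ⧸ p →+* P.ringCon.Quotient :=
    Ideal.Quotient.lift p (π.comp (algebraMap A R)) fun a ha ↦ (hker _).2 ha
  have hf : ∀ a, f (Ideal.Quotient.mk p a) = π (algebraMap A R a) := fun a ↦ rfl
  let _ : Algebra (A ⧸ p) P.ringCon.Quotient := f.toAlgebra' fun a x ↦ by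
    obtain ⟨a, rfl⟩ := Ideal.Quotient.mk_surjective a
    obtain ⟨x, rfl⟩ := hπ x
    rw [hf, ← map_mul, ← map_mul, Algebra.commutes]
  have : Module.Finite (A ⧸ p) P.ringCon.Quotient := by
    obtain ⟨t, ht⟩ := (inferInstance : Module.Finite A R).fg_top
    classical
    refine ⟨t.image π, ?_⟩
    rw [eq_top_iff]
    rintro y -
    obtain ⟨x, rfl⟩ := hπ y
    have hx : x ∈ Submodule.span A (t : Set R) := by rw [ht]; trivial
    induction hx using Submodule.span_induction with
    | mem x hx => exact Submodule.subset_span (by simpa using ⟨x, hx, rfl⟩)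
    | zero => rw [map_zero]; exact zero_mem _
    | add x y _ _ hx hy => rw [map_add]; exact add_mem hx hy
    | smul a x _ hx =>
      rw [Algebra.smul_def, map_mul, ← hf]
      exact Submodule.smul_mem _ (Ideal.Quotient.mk p a) hx
  let Q' : TwoSidedIdeal P.ringCon.Quotient := TwoSidedIdeal.mk' (π '' Q) ⟨0, Q.zero_mem, map_zero π⟩
    (by rintro _ _ ⟨x, hx, rfl⟩ ⟨y, hy, rfl⟩; exact ⟨_, Q.add_mem hx hy, map_add π x y⟩)
    (by rintro _ ⟨x, hx, rfl⟩; exact ⟨_, Q.neg_mem hx, map_neg π x⟩)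
    (by
      rintro y _ ⟨x, hx, rfl⟩
      obtain ⟨y, rfl⟩ := hπ y
      exact ⟨_, Q.mul_mem_left y x hx, map_mul π y x⟩)
    (by
      rintro _ y ⟨x, hx, rfl⟩
      obtain ⟨y, rfl⟩ := hπ y
      exact ⟨_, Q.mul_mem_right x y hx, map_mul π x y⟩)
  have hmem : ∀ y, y ∈ Q' ↔ y ∈ π '' (Q : Set R) := fun y ↦ TwoSidedIdeal.mem_mk' ..
  have hQ' : ∀ x, π x ∈ Q' → x ∈ Q := by
    intro x hx
    obtain ⟨y, hy, hxy⟩ := (hmem _).1 hx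
    have : y - x ∈ P := (hker _).1 (by rw [map_sub, hxy, sub_self])
    have := Q.sub_mem hy (hPQ.le this)
    rwa [sub_sub_cancel] at this
  obtain ⟨a, ha0, ha⟩ := exists_algebraMap_mem_of_injective (A := A ⧸ p) (R := P.ringCon.Quotient)
    (by
      rw [injective_iff_map_eq_zero]
      intro a ha
      obtain ⟨a, rfl⟩ := Ideal.Quotient.mk_surjective a
      exact Ideal.Quotient.eq_zero_iff_mem.2 ((hker _).1 ha))
    (by
      intro x y hxy
      obtain ⟨x, rfl⟩ := hπ x
      obtain ⟨y, rfl⟩ := hπ y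
      rw [hker, hker]
      refine hP.2 x y fun r ↦ ?_
      rw [← hker, map_mul, map_mul]
      exact hxy _)
    Q' (q := π q) ((hmem _).2 ⟨q, hqQ, rfl⟩) (mt (hker q).1 hqP)
  obtain ⟨a, rfl⟩ := Ideal.Quotient.mk_surjective a
  exact ha0 (Ideal.Quotient.eq_zero_iff_mem.2 (hle (hQ' _ ha)))

/-- If `R` is finite over the image of a domain `A` and `A → R` is central and not injective, then
the chains of primes of `R` are shorter than those of `A`. -/
theorem length_add_one_le_ringKrullDim {A R : Type*} [CommRing A] [IsDomain A] [Ring R]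
    [Algebra A R] [Module.Finite A R] {a : A} (ha : a ≠ 0) (ha' : algebraMap A R a = 0)
    (l : LTSeries {P : TwoSidedIdeal R // IsPrimeTwoSided P}) :
    ((l.length + 1 : ℕ) : WithBot ℕ∞) ≤ ringKrullDim A := by
  let f : {P : TwoSidedIdeal R // IsPrimeTwoSided P} → PrimeSpectrum A :=
    fun P ↦ primeContraction A P.1 P.2
  have hf : StrictMono f := fun P Q h ↦ primeContraction_lt P.2 Q.2 h
  -- All contractions contain `a ≠ 0`, so the zero ideal of `A` can be put below the contracted
  -- chain. This is the extra 1 in the bound.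
  have hbot : ⊥ < (l.map f hf).head := by
    refine bot_lt_iff_ne_bot.2 fun h ↦ ha ?_
    have : a ∈ (f l.head).asIdeal := by
      rw [mem_primeContraction, ha']; exact TwoSidedIdeal.zero_mem _
    rw [LTSeries.head_map] at h
    rwa [h] at this
  have h := Order.LTSeries.length_le_krullDim ((l.map f hf).cons ⊥ hbot)
  rwa [RelSeries.cons_length] at h

/-! ### Criteria for prime kernels and for linear independence. -/

theorem isPrimeTwoSided_ker {R D : Type*} [Ring R] [Ring D] [IsDomain D] (φ : R →+* D) :
    IsPrimeTwoSided (TwoSidedIdeal.ker φ) := by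
  refine ⟨fun h ↦ ?_, fun a b hab ↦ ?_⟩
  · have : (1 : R) ∈ TwoSidedIdeal.ker φ := by rw [h]; trivial
    rw [TwoSidedIdeal.mem_ker, map_one] at this
    exact one_ne_zero this
  · have := hab 1
    simpa only [TwoSidedIdeal.mem_ker, mul_one, map_mul, mul_eq_zero] using this

/-- The kernel of a homomorphism to a matrix ring over a domain is prime if the image spans a
submodule of full rank. -/
theorem isPrimeTwoSided_ker_of_matrix {R D n : Type*} [Ring R] [CommRing D] [IsDomain D]
    [Fintype n] [DecidableEq n] [Nonempty n] (φ : R →+* Matrix n n D)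
    (h : ∀ i j, ∃ d ≠ 0, Matrix.single i j d ∈ Submodule.span D (Set.range φ)) :
    IsPrimeTwoSided (TwoSidedIdeal.ker φ) := by
  refine ⟨fun h ↦ ?_, fun a b hab ↦ ?_⟩
  · have : (1 : R) ∈ TwoSidedIdeal.ker φ := by rw [h]; trivial
    rw [TwoSidedIdeal.mem_ker, map_one] at this
    exact one_ne_zero this
  · have key : ∀ M ∈ Submodule.span D (Set.range φ), φ a * M * φ b = 0 := by
      intro M hM
      induction hM using Submodule.span_induction with
      | mem M hM =>
        obtain ⟨r, rfl⟩ := hM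
        simpa only [TwoSidedIdeal.mem_ker, map_mul] using hab r
      | zero => simp
      | add M N _ _ hM hN => rw [mul_add, add_mul, hM, hN, add_zero]
      | smul c M _ hM => rw [mul_smul_comm, smul_mul_assoc, hM, smul_zero]
    rw [TwoSidedIdeal.mem_ker, TwoSidedIdeal.mem_ker]
    by_contra! hne
    obtain ⟨ha, hb⟩ := hne
    obtain ⟨k, i, hki⟩ : ∃ k i, φ a k i ≠ 0 := by
      by_contra! h0; exact ha (Matrix.ext h0)
    obtain ⟨j, l, hjl⟩ : ∃ j l, φ b j l ≠ 0 := by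
      by_contra! h0; exact hb (Matrix.ext h0)
    -- With E the matrix unit at (i, j), the (k, l) entry of φ(a)·dE·φ(b) is φ(a)ₖᵢ·d·φ(b)ⱼₗ, a
    -- product of nonzero elements of a domain.
    obtain ⟨d, hd, hmem⟩ := h i j
    have := congrFun (congrFun (key _ hmem) k) l
    simp only [Matrix.mul_apply, Matrix.single_apply, Matrix.zero_apply] at this
    rw [Finset.sum_eq_single j, Finset.sum_eq_single i] at this
    · simp_all
    · intro x _ hx; simp [hx.symm]
    · simp
    · intro x _ hx
      rw [Finset.sum_eq_zero, zero_mul]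
      intro y _; simp [hx.symm]
    · simp

/-- The peeling step: `G` sees only the component along `v`, and sees it faithfully, so an element
killed by `G` has no such component. -/
theorem Submodule.mem_of_linearIndependent_comp {K V D ι : Type*} [Field K] [AddCommGroup V]
    [Module K V] [AddCommGroup D] [Module K D] (G : V →ₗ[K] D) {W : Submodule K V}
    (hW : ∀ w ∈ W, G w = 0) {v : ι → V} (hv : LinearIndependent K (G ∘ v)) {f : V}
    (hf : f ∈ W ⊔ Submodule.span K (Set.range v)) (hG : G f = 0) : f ∈ W := by
  obtain ⟨w, hw, u, hu, rfl⟩ := Submodule.mem_sup.1 hf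
  obtain ⟨c, rfl⟩ := Finsupp.mem_span_range_iff_exists_finsupp.1 hu
  rw [map_add, hW w hw, zero_add, Finsupp.sum, map_sum] at hG
  have : c = 0 := linearIndependent_iff.1 hv c (by
    rw [Finsupp.linearCombination_apply, Finsupp.sum, ← hG]
    simp)
  simpa [this] using hw

theorem MvPolynomial.linearIndependent_of_monomials {K ι : Type*} [Field K]
    (u : ι → MvPolynomial (Fin 4) K) {e : ι → Fin 4 → ℕ} (he : Function.Injective e)
    (h : ∀ i, u i = X 0 ^ e i 0 * X 1 ^ e i 1 * X 2 ^ e i 2 * X 3 ^ e i 3) :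
    LinearIndependent K u := by
  have h' : u = basisMonomials (Fin 4) K ∘ fun i ↦ Finsupp.equivFunOnFinite.symm (e i) := by
    funext i
    rw [h, Function.comp, coe_basisMonomials]
    beta_reduce
    rw [monomial_eq, Finsupp.prod_fintype _ _ (by simp),
      Fin.prod_univ_four]
    simp
  rw [h']
  exact (basisMonomials (Fin 4) K).linearIndependent.comp _
    (Finsupp.equivFunOnFinite.symm.injective.comp he)

/-! ### Representations of K[S] and coordinates on normal forms. -/

namespace SkewExample

variable {K : Type*} [Field K]

/-- A quadruple satisfying the defining relations of `S`. -/
structure IsRealization {B : Type*} [Mul B] (y₁ y₂ y₃ y₄ : B) : Prop where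
  r43 : y₄ * y₃ = y₁ * y₄
  r42 : y₄ * y₂ = y₂ * y₄
  r41 : y₄ * y₁ = y₃ * y₄
  r32 : y₃ * y₂ = y₁ * y₃
  r31 : y₃ * y₁ = y₂ * y₃
  r21 : y₂ * y₁ = y₁ * y₂

/-- The homomorphism out of `S` determined by the images of the generators. -/
def IsRealization.monoidHom {B : Type*} [Monoid B] {y₁ y₂ y₃ y₄ : B}
    (h : IsRealization y₁ y₂ y₃ y₄) : S →* B :=
  PresentedMonoid.lift (fun | .x₁ => y₁ | .x₂ => y₂ | .x₃ => y₃ | .x₄ => y₄) fun a b hab ↦ by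
    cases hab
    exacts [h.r43, h.r42, h.r41, h.r32, h.r31, h.r21]

variable {B : Type*} [Ring B] [Algebra K B] {y₁ y₂ y₃ y₄ : B}

variable (K) in
/-- The homomorphism out of `K[S]` determined by the images of the generators. -/
noncomputable def IsRealization.algHom (h : IsRealization y₁ y₂ y₃ y₄) : MonoidAlgebra K S →ₐ[K] B :=
  MonoidAlgebra.lift K B S h.monoidHom

theorem IsRealization.algHom_emb (h : IsRealization y₁ y₂ y₃ y₄) (s : S) :
    h.algHom K (emb K s) = h.monoidHom s := MonoidAlgebra.lift_of ..

@[simp] theorem IsRealization.monoidHom_x₁ (h : IsRealization y₁ y₂ y₃ y₄) : h.monoidHom x₁ = y₁ := rfl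
@[simp] theorem IsRealization.monoidHom_x₂ (h : IsRealization y₁ y₂ y₃ y₄) : h.monoidHom x₂ = y₂ := rfl
@[simp] theorem IsRealization.monoidHom_x₃ (h : IsRealization y₁ y₂ y₃ y₄) : h.monoidHom x₃ = y₃ := rfl
@[simp] theorem IsRealization.monoidHom_x₄ (h : IsRealization y₁ y₂ y₃ y₄) : h.monoidHom x₄ = y₄ := rfl

@[simp] theorem emb_mul (s t : S) : emb K (s * t) = emb K s * emb K t := map_mul _ _ _
@[simp] theorem emb_pow (s : S) (n : ℕ) : emb K (s ^ n) = emb K s ^ n := map_pow _ _ _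
@[simp] theorem emb_one : emb K 1 = 1 := map_one _

theorem mem_of_forall_emb_mem (W : Submodule K (MonoidAlgebra K S)) (h : ∀ s, emb K s ∈ W)
    (f : MonoidAlgebra K S) : f ∈ W := by
  induction f using MonoidAlgebra.induction_on with
  | of s => exact h s
  | add f g hf hg => exact add_mem hf hg
  | smul c f hf => exact W.smul_mem c hf

/-- A two-sided ideal as a linear subspace. -/
noncomputable def subspace (P : TwoSidedIdeal (MonoidAlgebra K S)) : Submodule K (MonoidAlgebra K S) :=
  P.asIdeal.restrictScalars K

/-- This is how a kernel is shown to be no larger than Pᵢ: modulo `P` the elements `n i` span K[S],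
and `G` is injective on their span. -/
theorem mem_of_map_eq_zero {ι : Type*} (P : TwoSidedIdeal (MonoidAlgebra K S))
    (G : MonoidAlgebra K S →ₗ[K] MvPolynomial (Fin 4) K) (hP : ∀ f ∈ P, G f = 0) (n : ι → S)
    (hn : LinearIndependent K fun i ↦ G (emb K (n i)))
    (hcov : ∀ s, emb K s ∈ P ∨ ∃ i, emb K s - emb K (n i) ∈ P)
    {f : MonoidAlgebra K S} (hf : G f = 0) : f ∈ P := by
  refine Submodule.mem_of_linearIndependent_comp G (W := subspace P) hP (v := fun i ↦ emb K (n i))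
    hn (mem_of_forall_emb_mem _ (fun s ↦ ?_) f) hf
  rcases hcov s with h | ⟨i, h⟩
  · exact Submodule.mem_sup_left h
  · exact Submodule.mem_sup.2 ⟨_, h, emb K (n i), Submodule.subset_span ⟨i, rfl⟩, by abel⟩

/-! ### The four realizations -/

open MvPolynomial Matrix

/-- The transposition matrix. -/
def swap (D : Type*) [Zero D] [One D] : Matrix (Fin 2) (Fin 2) D := !![0, 1; 1, 0]

/-- The all-ones vector is fixed by the transposition, so applying matrices to it makes the parity
of the exponent disappear. -/
theorem swap_smul_pow_mulVec {D : Type*} [CommRing D] (t : D) (n : ℕ) :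
    (t • swap D) ^ n *ᵥ 1 = fun _ ↦ t ^ n := by
  induction n with
  | zero => simp; rfl
  | succ n ih =>
    rw [pow_succ', ← Matrix.mulVec_mulVec, ih]
    ext i; fin_cases i <;> simp [swap, Matrix.mulVec, dotProduct, pow_succ']

variable (K) in
theorem realization₁ : IsRealization (X 0 : MvPolynomial (Fin 4) K) (X 0) (X 0) (X 3) where
  r43 := mul_comm _ _
  r42 := mul_comm _ _
  r41 := mul_comm _ _
  r32 := mul_comm _ _
  r31 := mul_comm _ _
  r21 := mul_comm _ _

variable (K) in
theorem realization₂ : IsRealization (diagonal ![X 0, X 1] : Matrix (Fin 2) (Fin 2) (MvPolynomial (Fin 4) K))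
    (diagonal ![X 1, X 0]) ((X 2 : MvPolynomial (Fin 4) K) • swap _) 0 where
  r43 := by simp
  r42 := by simp
  r41 := by simp
  r32 := by ext i j : 2; fin_cases i <;> fin_cases j <;> simp [swap, mul_comm]
  r31 := by ext i j : 2; fin_cases i <;> fin_cases j <;> simp [swap, mul_comm]
  r21 := by ext i j : 2; fin_cases i <;> fin_cases j <;> simp [mul_comm]

variable (K) in
theorem realization₃ : IsRealization (0 : MvPolynomial (Fin 4) K) (X 1) 0 (X 3) where
  r43 := by simp
  r42 := mul_comm _ _
  r41 := by simp
  r32 := by simp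
  r31 := by simp
  r21 := by simp

variable (K) in
theorem realization₄ : IsRealization (diagonal ![X 0, 0] : Matrix (Fin 2) (Fin 2) (MvPolynomial (Fin 4) K))
    0 (diagonal ![0, X 0]) ((X 3 : MvPolynomial (Fin 4) K) • swap _) where
  r43 := by ext i j : 2; fin_cases i <;> fin_cases j <;> simp [swap, mul_comm]
  r42 := by simp
  r41 := by ext i j : 2; fin_cases i <;> fin_cases j <;> simp [swap, mul_comm]
  r32 := by ext i j : 2; fin_cases i <;> fin_cases j <;> simp
  r31 := by ext i j : 2; fin_cases i <;> fin_cases j <;> simp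
  r21 := by ext i j : 2; fin_cases i <;> fin_cases j <;> simp

variable (K)

/-- Linear functional separating the normal forms modulo `P₁`. -/
noncomputable def coord₁ : MonoidAlgebra K S →ₗ[K] MvPolynomial (Fin 4) K :=
  ((realization₁ K).algHom K).toLinearMap

/-- Linear functional separating the normal forms modulo `P₂`. -/
noncomputable def coord₂ : MonoidAlgebra K S →ₗ[K] MvPolynomial (Fin 4) K :=
  { toFun := fun f ↦ ((realization₂ K).algHom K f *ᵥ 1) 0
    map_add' := fun f g ↦ by simp [Matrix.add_mulVec]
    map_smul' := fun c f ↦ by simp [Matrix.smul_mulVec] }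

/-- Linear functional separating the normal forms modulo `P₃`. -/
noncomputable def coord₃ : MonoidAlgebra K S →ₗ[K] MvPolynomial (Fin 4) K :=
  ((realization₃ K).algHom K).toLinearMap

/-- Linear functional separating the normal forms modulo `P₄`. -/
noncomputable def coord₄ : MonoidAlgebra K S →ₗ[K] MvPolynomial (Fin 4) K :=
  -- The entries of the vector record powers of x₁ and of x₃ respectively. The variable `X 2`,
  -- absent from `realization₄`, tags the second entry. Subtracting its value at X₀ = 0 removes the
  -- pure powers of x₄, which both entries would count.
  { toFun := fun f ↦ ((realization₄ K).algHom K f *ᵥ 1) 0 + X 2 *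
      (((realization₄ K).algHom K f *ᵥ 1) 1 -
        aeval (Function.update X 0 0 : Fin 4 → MvPolynomial (Fin 4) K) (((realization₄ K).algHom K f *ᵥ 1) 1))
    map_add' := fun f g ↦ by simp [Matrix.add_mulVec]; ring
    map_smul' := fun c f ↦ by
      simp only [map_smul, Matrix.smul_mulVec, Pi.smul_apply, RingHom.id_apply, mul_sub, smul_sub,
        smul_add, mul_smul_comm] }

theorem coord₁_emb (s : S) : coord₁ K (emb K s) = (realization₁ K).monoidHom s :=
  (realization₁ K).algHom_emb s

theorem coord₃_emb (s : S) : coord₃ K (emb K s) = (realization₃ K).monoidHom s :=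
  (realization₃ K).algHom_emb s

theorem coord₂_emb (a b c : ℕ) :
    coord₂ K (emb K (x₁ ^ a * x₂ ^ b * x₃ ^ c)) = X 0 ^ a * X 1 ^ b * X 2 ^ c := by
  change ((realization₂ K).algHom K _ *ᵥ 1) 0 = _
  rw [(realization₂ K).algHom_emb]
  simp only [map_mul, map_pow, IsRealization.monoidHom_x₁, IsRealization.monoidHom_x₂, IsRealization.monoidHom_x₃,
    ← Matrix.mulVec_mulVec, swap_smul_pow_mulVec, Matrix.diagonal_pow, Matrix.mulVec_diagonal]
  simp [mul_assoc]

theorem coord₄_emb_inl (a d : ℕ) : coord₄ K (emb K (x₁ ^ a * x₄ ^ d)) = X 0 ^ a * X 3 ^ d := by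
  change ((realization₄ K).algHom K _ *ᵥ 1) 0 + X 2 *
      (((realization₄ K).algHom K _ *ᵥ 1) 1 - aeval _ (((realization₄ K).algHom K _ *ᵥ 1) 1)) = _
  rw [(realization₄ K).algHom_emb]
  simp only [map_mul, map_pow, IsRealization.monoidHom_x₁, IsRealization.monoidHom_x₄,
    ← Matrix.mulVec_mulVec, swap_smul_pow_mulVec, Matrix.diagonal_pow, Matrix.mulVec_diagonal]
  rcases a with - | a <;> simp

theorem coord₄_emb_inr (a d : ℕ) :
    coord₄ K (emb K (x₃ ^ (a + 1) * x₄ ^ d)) = X 0 ^ (a + 1) * X 2 * X 3 ^ d := by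
  change ((realization₄ K).algHom K _ *ᵥ 1) 0 + X 2 *
      (((realization₄ K).algHom K _ *ᵥ 1) 1 - aeval _ (((realization₄ K).algHom K _ *ᵥ 1) 1)) = _
  rw [(realization₄ K).algHom_emb]
  simp only [map_mul, map_pow, IsRealization.monoidHom_x₃, IsRealization.monoidHom_x₄,
    ← Matrix.mulVec_mulVec, swap_smul_pow_mulVec, Matrix.diagonal_pow, Matrix.mulVec_diagonal]
  simp
  ring

theorem linearIndependent_coord₁ :
    LinearIndependent K fun i : ℕ × ℕ ↦ coord₁ K (emb K (x₁ ^ i.1 * x₄ ^ i.2)) := by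
  refine MvPolynomial.linearIndependent_of_monomials _ (e := fun i ↦ ![i.1, 0, 0, i.2]) ?_ ?_
  · rintro ⟨a, b⟩ ⟨c, d⟩ h
    exact Prod.ext (congrFun h 0) (congrFun h 3)
  · intro i; simp [coord₁_emb, -emb_mul]

theorem linearIndependent_coord₂ : LinearIndependent K fun i : ℕ × ℕ × ℕ ↦
    coord₂ K (emb K (x₁ ^ i.1 * x₂ ^ i.2.1 * x₃ ^ i.2.2)) := by
  refine MvPolynomial.linearIndependent_of_monomials _ (e := fun i ↦ ![i.1, i.2.1, i.2.2, 0]) ?_ ?_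
  · rintro ⟨a, b, c⟩ ⟨a', b', c'⟩ h
    exact Prod.ext (congrFun h 0) (Prod.ext (congrFun h 1) (congrFun h 2))
  · intro i; simp [coord₂_emb, -emb_mul]

theorem linearIndependent_coord₃ :
    LinearIndependent K fun i : ℕ × ℕ ↦ coord₃ K (emb K (x₂ ^ i.1 * x₄ ^ i.2)) := by
  refine MvPolynomial.linearIndependent_of_monomials _ (e := fun i ↦ ![0, i.1, 0, i.2]) ?_ ?_
  · rintro ⟨a, b⟩ ⟨c, d⟩ h
    exact Prod.ext (congrFun h 1) (congrFun h 3)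
  · intro i; simp [coord₃_emb, -emb_mul]

/-- Normal forms of the elements of `S` outside the ideal generated by `x₂`. -/
def normalForm₄ : ℕ × ℕ ⊕ ℕ × ℕ → S
  | .inl (a, d) => x₁ ^ a * x₄ ^ d
  -- The exponent `a + 1` keeps x₄ᵈ from being listed twice.
  | .inr (a, d) => x₃ ^ (a + 1) * x₄ ^ d

theorem linearIndependent_coord₄ :
    LinearIndependent K fun i ↦ coord₄ K (emb K (normalForm₄ i)) := by
  refine MvPolynomial.linearIndependent_of_monomials _
    (e := Sum.elim (fun i ↦ ![i.1, 0, 0, i.2]) fun i ↦ ![i.1 + 1, 0, 1, i.2]) ?_ ?_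
  · rintro (⟨a, b⟩ | ⟨a, b⟩) (⟨c, d⟩ | ⟨c, d⟩) h
    · exact congrArg Sum.inl (Prod.ext (congrFun h 0) (congrFun h 3))
    · exact absurd (congrFun h 2) (by simp)
    · exact absurd (congrFun h 2) (by simp)
    · exact congrArg Sum.inr (Prod.ext (Nat.succ_injective (congrFun h 0)) (congrFun h 3))
  · rintro (⟨a, b⟩ | ⟨a, b⟩)
    · rw [normalForm₄, coord₄_emb_inl]; simp
    · rw [normalForm₄, coord₄_emb_inr]; simp

end SkewExample

/-! ### The ideals Pᵢ as prime kernels with zero intersection; the least cancellative congruence. -/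

namespace SkewExample

open MvPolynomial Matrix

variable (K : Type*) [Field K]

theorem IsRealization.span_le_ker {K : Type*} [Field K] {B : Type*} [Ring B] [Algebra K B]
    {y₁ y₂ y₃ y₄ : B} (h : IsRealization y₁ y₂ y₃ y₄) {s : Set (MonoidAlgebra K S)}
    (hs : ∀ f ∈ s, h.algHom K f = 0) {f : MonoidAlgebra K S} (hf : f ∈ TwoSidedIdeal.span s) :
    h.algHom K f = 0 := by
  have : TwoSidedIdeal.span s ≤ TwoSidedIdeal.ker (h.algHom K) :=
    TwoSidedIdeal.span_le.2 fun f hf ↦ (TwoSidedIdeal.mem_ker _).2 (hs f hf)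
  exact (TwoSidedIdeal.mem_ker _).1 (this hf)

/-- The kernel of the homomorphism out of `K[S]` determined by a realization. -/
noncomputable def IsRealization.ker {B : Type*} [Ring B] [Algebra K B]
    {y₁ y₂ y₃ y₄ : B} (h : IsRealization y₁ y₂ y₃ y₄) : TwoSidedIdeal (MonoidAlgebra K S) :=
  TwoSidedIdeal.ker (h.algHom K : MonoidAlgebra K S →+* B)

variable {K} in
theorem IsRealization.mem_ker {B : Type*} [Ring B] [Algebra K B]
    {y₁ y₂ y₃ y₄ : B} {h : IsRealization y₁ y₂ y₃ y₄} {f : MonoidAlgebra K S} :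
    f ∈ h.ker K ↔ h.algHom K f = 0 := TwoSidedIdeal.mem_ker _

variable {K} in
theorem emb_mul_mul_mem {P : TwoSidedIdeal (MonoidAlgebra K S)} {x : S} (hx : emb K x ∈ P) (s t : S) :
    emb K (s * x * t) ∈ P := by
  rw [emb_mul, emb_mul]; exact P.mul_mem_right _ _ (P.mul_mem_left _ _ hx)

theorem P₁_eq_ker : P₁ K = (realization₁ K).ker K := by
  have hle : ∀ f ∈ P₁ K, (realization₁ K).algHom K f = 0 := fun f hf ↦ by
    refine IsRealization.span_le_ker _ ?_ hf
    rintro f (rfl | rfl) <;> simp [IsRealization.algHom_emb]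
  refine le_antisymm (fun f hf ↦ IsRealization.mem_ker.2 (hle f hf)) fun f hf ↦ ?_
  refine mem_of_map_eq_zero (P₁ K) (coord₁ K) hle _ (linearIndependent_coord₁ K) (fun s ↦ .inr ?_)
    (IsRealization.mem_ker.1 hf)
  obtain ⟨a, b, c, d, rfl⟩ := exists_ordered s
  refine ⟨(a + b + c, d), ?_⟩
  let π := (P₁ K).ringCon.mk'
  have hker : ∀ x, π x = 0 ↔ x ∈ P₁ K := fun x ↦ by
    rw [← TwoSidedIdeal.mem_ker, TwoSidedIdeal.ker_ringCon_mk']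
  have h12 : π (emb K x₁) = π (emb K x₂) := by
    rw [← sub_eq_zero, ← map_sub, hker]; exact TwoSidedIdeal.subset_span (by simp)
  have h23 : π (emb K x₂) = π (emb K x₃) := by
    rw [← sub_eq_zero, ← map_sub, hker]; exact TwoSidedIdeal.subset_span (by simp)
  rw [← hker, map_sub, sub_eq_zero]
  simp only [emb_mul, emb_pow, map_mul, map_pow, ← h23, ← h12, pow_add]

theorem coord₂_eq_zero {f : MonoidAlgebra K S} (hf : (realization₂ K).algHom K f = 0) :
    coord₂ K f = 0 := by
  change ((realization₂ K).algHom K f *ᵥ 1) 0 = 0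
  rw [hf, zero_mulVec, Pi.zero_apply]

theorem P₂_eq_ker : P₂ K = (realization₂ K).ker K := by
  have hle : ∀ f ∈ P₂ K, (realization₂ K).algHom K f = 0 := fun f hf ↦ by
    refine IsRealization.span_le_ker _ ?_ hf
    rintro f rfl; simp [IsRealization.algHom_emb]
  refine le_antisymm (fun f hf ↦ IsRealization.mem_ker.2 (hle f hf)) fun f hf ↦ ?_
  refine mem_of_map_eq_zero (P₂ K) (coord₂ K) (fun f hf ↦ coord₂_eq_zero K (hle f hf)) _
    (linearIndependent_coord₂ K) (fun s ↦ ?_) (coord₂_eq_zero K (IsRealization.mem_ker.1 hf))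
  obtain ⟨a, b, c, d, rfl⟩ := exists_ordered s
  have hx : emb K x₄ ∈ P₂ K := TwoSidedIdeal.subset_span rfl
  rcases d with - | d
  · exact .inr ⟨(a, b, c), by simp⟩
  · left
    simpa only [mul_one, mul_assoc, pow_succ] using
      emb_mul_mul_mem hx (x₁ ^ a * x₂ ^ b * x₃ ^ c * x₄ ^ d) 1

theorem P₃_eq_ker : P₃ K = (realization₃ K).ker K := by
  have hle : ∀ f ∈ P₃ K, (realization₃ K).algHom K f = 0 := fun f hf ↦ by
    refine IsRealization.span_le_ker _ ?_ hf
    rintro f (rfl | rfl) <;> simp [IsRealization.algHom_emb]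
  refine le_antisymm (fun f hf ↦ IsRealization.mem_ker.2 (hle f hf)) fun f hf ↦ ?_
  refine mem_of_map_eq_zero (P₃ K) (coord₃ K) hle _ (linearIndependent_coord₃ K) (fun s ↦ ?_)
    (IsRealization.mem_ker.1 hf)
  obtain ⟨a, b, c, d, rfl⟩ := exists_ordered s
  have hx₁ : emb K x₁ ∈ P₃ K := TwoSidedIdeal.subset_span (by simp)
  have hx₃ : emb K x₃ ∈ P₃ K := TwoSidedIdeal.subset_span (by simp)
  rcases a with - | a
  · rcases c with - | c
    · exact .inr ⟨(b, d), by simp⟩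
    · left
      simpa only [one_mul, pow_zero, mul_assoc, pow_succ] using
        emb_mul_mul_mem hx₃ (x₂ ^ b * x₃ ^ c) (x₄ ^ d)
  · left
    simpa only [mul_assoc, pow_succ] using emb_mul_mul_mem hx₁ (x₁ ^ a) (x₂ ^ b * x₃ ^ c * x₄ ^ d)

theorem coord₄_eq_zero {f : MonoidAlgebra K S} (hf : (realization₄ K).algHom K f = 0) :
    coord₄ K f = 0 := by
  change ((realization₄ K).algHom K _ *ᵥ 1) 0 + X 2 *
      (((realization₄ K).algHom K _ *ᵥ 1) 1 - aeval _ (((realization₄ K).algHom K _ *ᵥ 1) 1)) = _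
  rw [hf, zero_mulVec, Pi.zero_apply, Pi.zero_apply, map_zero, sub_zero, mul_zero, add_zero]

theorem P₄_eq_ker : P₄ K = (realization₄ K).ker K := by
  have hle : ∀ f ∈ P₄ K, (realization₄ K).algHom K f = 0 := fun f hf ↦ by
    refine IsRealization.span_le_ker _ ?_ hf
    rintro f rfl; simp [IsRealization.algHom_emb]
  refine le_antisymm (fun f hf ↦ IsRealization.mem_ker.2 (hle f hf)) fun f hf ↦ ?_
  refine mem_of_map_eq_zero (P₄ K) (coord₄ K) (fun f hf ↦ coord₄_eq_zero K (hle f hf)) _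
    (linearIndependent_coord₄ K) (fun s ↦ ?_) (coord₄_eq_zero K (IsRealization.mem_ker.1 hf))
  obtain ⟨a, b, c, d, rfl⟩ := exists_ordered s
  have hx : emb K x₂ ∈ P₄ K := TwoSidedIdeal.subset_span rfl
  rcases b with - | b
  · rcases a with - | a
    · rcases c with - | c
      · exact .inr ⟨.inl (0, d), by simp [normalForm₄]⟩
      · exact .inr ⟨.inr (c, d), by simp [normalForm₄]⟩
    · rcases c with - | c
      · exact .inr ⟨.inl (a + 1, d), by simp [normalForm₄]⟩
      · left
        -- The product x₁x₃ = x₃x₂ lies in the ideal generated by x₂.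
        have := emb_mul_mul_mem hx (x₁ ^ a * x₃) (x₃ ^ c * x₄ ^ d)
        rw [mul_assoc (x₁ ^ a), x₃_mul_x₂] at this
        simpa only [pow_zero, mul_one, mul_assoc, pow_succ x₁, pow_succ' x₃] using this
  · left
    simpa only [mul_assoc, pow_succ] using emb_mul_mul_mem hx (x₁ ^ a * x₂ ^ b) (x₃ ^ c * x₄ ^ d)

theorem isPrime_P₁ : IsPrimeTwoSided (P₁ K) := by
  rw [P₁_eq_ker]; exact isPrimeTwoSided_ker _

theorem isPrime_P₃ : IsPrimeTwoSided (P₃ K) := by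
  rw [P₃_eq_ker]; exact isPrimeTwoSided_ker _

theorem isPrime_P₂ : IsPrimeTwoSided (P₂ K) := by
  rw [P₂_eq_ker]
  refine isPrimeTwoSided_ker_of_matrix _ ?_
  let W := Submodule.span (MvPolynomial (Fin 4) K) (Set.range
    ((realization₂ K).algHom K : MonoidAlgebra K S →+* Matrix (Fin 2) (Fin 2) (MvPolynomial (Fin 4) K)))
  have hW : ∀ s, (realization₂ K).monoidHom s ∈ W := fun s ↦
    Submodule.subset_span ⟨emb K s, (realization₂ K).algHom_emb s⟩
  have hd : (X 0 ^ 2 - X 1 ^ 2 : MvPolynomial (Fin 4) K) ≠ 0 := fun h ↦ by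
    have := congrArg (MvPolynomial.eval ![1, 0, 0, 0]) h
    simp at this
  -- As x₁ and x₂ act by diag(X₀, X₁) and diag(X₁, X₀), the combination X₀x₁ - X₁x₂ has a single
  -- nonzero entry. Multiplying by x₃ on the right gives the off-diagonal units.
  have h00 : single 0 0 (X 0 ^ 2 - X 1 ^ 2 : MvPolynomial (Fin 4) K) ∈ W := by
    convert sub_mem (W.smul_mem (X 0) (hW x₁)) (W.smul_mem (X 1) (hW x₂)) using 1
    refine Matrix.ext fun i j ↦ ?_; fin_cases i <;> fin_cases j <;> simp [Matrix.single, sq, mul_comm]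
  have h11 : single 1 1 (X 0 ^ 2 - X 1 ^ 2 : MvPolynomial (Fin 4) K) ∈ W := by
    convert sub_mem (W.smul_mem (X 0) (hW x₂)) (W.smul_mem (X 1) (hW x₁)) using 1
    refine Matrix.ext fun i j ↦ ?_; fin_cases i <;> fin_cases j <;> simp [Matrix.single, sq, mul_comm]
  have h01 : single 0 1 ((X 0 ^ 2 - X 1 ^ 2) * X 2 : MvPolynomial (Fin 4) K) ∈ W := by
    convert sub_mem (W.smul_mem (X 0) (hW (x₁ * x₃))) (W.smul_mem (X 1) (hW (x₂ * x₃))) using 1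
    refine Matrix.ext fun i j ↦ ?_; fin_cases i <;> fin_cases j <;> simp [Matrix.single, swap] <;> ring
  have h10 : single 1 0 ((X 0 ^ 2 - X 1 ^ 2) * X 2 : MvPolynomial (Fin 4) K) ∈ W := by
    convert sub_mem (W.smul_mem (X 0) (hW (x₂ * x₃))) (W.smul_mem (X 1) (hW (x₁ * x₃))) using 1
    refine Matrix.ext fun i j ↦ ?_; fin_cases i <;> fin_cases j <;> simp [Matrix.single, swap] <;> ring
  intro i j
  fin_cases i <;> fin_cases j
  exacts [⟨_, hd, h00⟩, ⟨_, mul_ne_zero hd (X_ne_zero 2), h01⟩,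
    ⟨_, mul_ne_zero hd (X_ne_zero 2), h10⟩, ⟨_, hd, h11⟩]

theorem isPrime_P₄ : IsPrimeTwoSided (P₄ K) := by
  rw [P₄_eq_ker]
  refine isPrimeTwoSided_ker_of_matrix _ ?_
  let W := Submodule.span (MvPolynomial (Fin 4) K) (Set.range
    ((realization₄ K).algHom K : MonoidAlgebra K S →+* Matrix (Fin 2) (Fin 2) (MvPolynomial (Fin 4) K)))
  have hW : ∀ s, (realization₄ K).monoidHom s ∈ W := fun s ↦
    Submodule.subset_span ⟨emb K s, (realization₄ K).algHom_emb s⟩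
  have h00 : single 0 0 (X 0 : MvPolynomial (Fin 4) K) ∈ W := by
    convert hW x₁ using 1
    refine Matrix.ext fun i j ↦ ?_; fin_cases i <;> fin_cases j <;> simp [Matrix.single]
  have h11 : single 1 1 (X 0 : MvPolynomial (Fin 4) K) ∈ W := by
    convert hW x₃ using 1
    refine Matrix.ext fun i j ↦ ?_; fin_cases i <;> fin_cases j <;> simp [Matrix.single]
  have h01 : single 0 1 (X 0 * X 3 : MvPolynomial (Fin 4) K) ∈ W := by
    convert hW (x₁ * x₄) using 1
    refine Matrix.ext fun i j ↦ ?_; fin_cases i <;> fin_cases j <;> simp [Matrix.single, swap]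
  have h10 : single 1 0 (X 0 * X 3 : MvPolynomial (Fin 4) K) ∈ W := by
    convert hW (x₃ * x₄) using 1
    refine Matrix.ext fun i j ↦ ?_; fin_cases i <;> fin_cases j <;> simp [Matrix.single, swap]
  have hd : (X 0 * X 3 : MvPolynomial (Fin 4) K) ≠ 0 := mul_ne_zero (X_ne_zero 0) (X_ne_zero 3)
  intro i j
  fin_cases i <;> fin_cases j
  exacts [⟨_, X_ne_zero 0, h00⟩, ⟨_, hd, h01⟩, ⟨_, hd, h10⟩, ⟨_, X_ne_zero 0, h11⟩]

/-! ### Semiprimeness -/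

-- The system is triangular. P₂ kills every normal form containing x₄ and so removes `v₂`; then P₃
-- kills `v₄` and `v₁` and removes `v₃`; then P₄ kills `v₁` and removes `v₄`; finally P₁ is faithful
-- on the span of `v₁`.
variable {K} in
theorem eq_zero_of_mem {f : MonoidAlgebra K S} (h₁ : f ∈ P₁ K) (h₂ : f ∈ P₂ K) (h₃ : f ∈ P₃ K)
    (h₄ : f ∈ P₄ K) : f = 0 := by
  rw [P₁_eq_ker, IsRealization.mem_ker] at h₁
  rw [P₂_eq_ker, IsRealization.mem_ker] at h₂
  rw [P₃_eq_ker, IsRealization.mem_ker] at h₃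
  rw [P₄_eq_ker, IsRealization.mem_ker] at h₄
  let v₁ : ℕ × ℕ → MonoidAlgebra K S := fun i ↦ emb K (mixed i.1 * x₄ ^ i.2)
  let v₂ : ℕ × ℕ × ℕ → MonoidAlgebra K S := fun i ↦ emb K (x₁ ^ i.1 * x₂ ^ i.2.1 * x₃ ^ i.2.2)
  let v₃ : ℕ × ℕ → MonoidAlgebra K S := fun i ↦ emb K (x₂ ^ i.1 * x₄ ^ (i.2 + 1))
  -- The shifts make both exponents positive; in the second summand `normalForm₄` already shifts the
  -- exponent of x₃.
  let j₄ : ℕ × ℕ ⊕ ℕ × ℕ → ℕ × ℕ ⊕ ℕ × ℕ := Sum.map (Prod.map (· + 1) (· + 1)) (Prod.map id (· + 1))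
  let v₄ : ℕ × ℕ ⊕ ℕ × ℕ → MonoidAlgebra K S := fun i ↦ emb K (normalForm₄ (j₄ i))
  have hsucc : Function.Injective (· + 1 : ℕ → ℕ) := add_left_injective 1
  have hv₄ : LinearIndependent K (coord₄ K ∘ v₄) :=
    (linearIndependent_coord₄ K).comp j₄ ((hsucc.prodMap hsucc).sumMap
      (Function.injective_id.prodMap hsucc))
  have hv₃ : LinearIndependent K (coord₃ K ∘ v₃) :=
    (linearIndependent_coord₃ K).comp (Prod.map id (· + 1)) (Function.injective_id.prodMap hsucc)
  have hv₁ : LinearIndependent K (coord₁ K ∘ v₁) := by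
    refine MvPolynomial.linearIndependent_of_monomials _ (e := fun i ↦ ![i.1 + 2, 0, 0, i.2 + 1]) ?_ ?_
    · rintro ⟨a, b⟩ ⟨c, d⟩ h
      exact Prod.ext (Nat.add_right_cancel (congrFun h 0)) (Nat.add_right_cancel (congrFun h 3))
    · intro i
      rw [Function.comp, coord₁_emb]
      simp [mixed]
      ring
  let W₁ := Submodule.span K (Set.range v₁)
  let W₄ := W₁ ⊔ Submodule.span K (Set.range v₄)
  let W₃ := W₄ ⊔ Submodule.span K (Set.range v₃)
  have hkill : ∀ (G : MonoidAlgebra K S →ₗ[K] MvPolynomial (Fin 4) K) {ι : Type}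
      (v : ι → MonoidAlgebra K S) (W : Submodule K (MonoidAlgebra K S)), (∀ i, G (v i) = 0) →
      (∀ w ∈ W, G w = 0) → ∀ w ∈ W ⊔ Submodule.span K (Set.range v), G w = 0 := by
    intro G ι v W hv hW
    have : W ⊔ Submodule.span K (Set.range v) ≤ LinearMap.ker G :=
      sup_le hW (Submodule.span_le.2 (by rintro _ ⟨i, rfl⟩; exact hv i))
    exact this
  have hkill₁ : ∀ (G : MonoidAlgebra K S →ₗ[K] MvPolynomial (Fin 4) K), (∀ i, G (v₁ i) = 0) →
      ∀ w ∈ W₁, G w = 0 := fun G hG w hw ↦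
    hkill G v₁ ⊥ hG (by simp) w (by rwa [bot_sup_eq])
  have m₃ : f ∈ W₃ := by
    refine Submodule.mem_of_linearIndependent_comp (coord₂ K) ?_
      (linearIndependent_coord₂ K : LinearIndependent K (coord₂ K ∘ v₂)) ?_ (coord₂_eq_zero K h₂)
    · have hx₄ : ∀ s d t, coord₂ K (emb K (s * x₄ ^ (d + 1) * t)) = 0 := fun s d t ↦
        coord₂_eq_zero K (by simp [IsRealization.algHom_emb, -emb_mul])
      refine hkill _ _ _ (fun i ↦ ?_) (hkill _ _ _ (fun i ↦ ?_) (hkill₁ _ fun i ↦ ?_))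
      · simpa only [mul_one] using hx₄ (x₂ ^ i.1) i.2 1
      · rcases i with ⟨a, d⟩ | ⟨a, d⟩
        · have := hx₄ (x₁ ^ (a + 1)) d 1; rwa [mul_one] at this
        · have := hx₄ (x₃ ^ (a + 1)) d 1; rwa [mul_one] at this
      · have := hx₄ (x₁ ^ (i.1 + 1) * x₂) 0 (x₄ ^ i.2)
        rwa [zero_add, pow_one] at this
    · refine mem_of_forall_emb_mem _ (fun s ↦ ?_) f
      rcases normal_form s with ⟨a, b, c, rfl⟩ | ⟨b, d, rfl⟩ | ⟨a, d, rfl⟩ | ⟨c, d, rfl⟩ | ⟨k, d, rfl⟩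
      · exact Submodule.mem_sup_right (Submodule.subset_span ⟨(a, b, c), rfl⟩)
      all_goals refine Submodule.mem_sup_left ?_
      · exact Submodule.mem_sup_right (Submodule.subset_span ⟨(b, d), rfl⟩)
      all_goals refine Submodule.mem_sup_left ?_
      · exact Submodule.mem_sup_right (Submodule.subset_span ⟨.inl (a, d), rfl⟩)
      · exact Submodule.mem_sup_right (Submodule.subset_span ⟨.inr (c, d), rfl⟩)
      · exact Submodule.mem_sup_left (Submodule.subset_span ⟨(k, d), rfl⟩)
  have m₄ : f ∈ W₄ := by
    refine Submodule.mem_of_linearIndependent_comp (coord₃ K) ?_ hv₃ m₃ h₃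
    refine hkill _ _ _ (fun i ↦ ?_) (hkill₁ _ fun i ↦ ?_)
    · rcases i with ⟨a, d⟩ | ⟨a, d⟩ <;> simp [v₄, j₄, normalForm₄, coord₃_emb, -emb_mul]
    · simp [v₁, mixed, coord₃_emb, -emb_mul]
  have m₁ : f ∈ W₁ := by
    refine Submodule.mem_of_linearIndependent_comp (coord₄ K) (hkill₁ _ fun i ↦ ?_) hv₄ m₄
      (coord₄_eq_zero K h₄)
    exact coord₄_eq_zero K (by simp [v₁, mixed, IsRealization.algHom_emb, -emb_mul])
  have m₀ : f ∈ (⊥ : Submodule K (MonoidAlgebra K S)) :=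
    Submodule.mem_of_linearIndependent_comp (coord₁ K) (by simp) hv₁ (by rwa [bot_sup_eq]) h₁
  exact (Submodule.mem_bot K).1 m₀

theorem isSemiprimeRing : IsSemiprimeRing (MonoidAlgebra K S) := by
  intro a ha
  have h : ∀ P : TwoSidedIdeal (MonoidAlgebra K S), IsPrimeTwoSided P → a ∈ P := fun P hP ↦
    or_self_iff.1 (hP.2 a a fun r ↦ by rw [ha r]; exact P.zero_mem)
  exact eq_zero_of_mem (h _ (isPrime_P₁ K)) (h _ (isPrime_P₂ K)) (h _ (isPrime_P₃ K))
    (h _ (isPrime_P₄ K))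

/-! ### The least cancellative congruence -/

theorem P₁_eq_conIdeal : P₁ K = conIdeal K (leastCancelCon S) := by
  -- Cancelling x₄ gives x₁x₃ = x₁x₂ = x₂x₃, whence x₁ = x₂ and x₂ = x₃.
  have hx : ∀ c : Con S, IsCancelMul c.Quotient → c x₁ x₂ ∧ c x₂ x₃ := by
    intro c hc
    have h := congrArg c.mk' x₁_mul_x₃_mul_x₄
    have h' := congrArg c.mk' x₂_mul_x₃_mul_x₄
    simp only [map_mul] at h h'
    have e₁ := mul_right_cancel h
    have e₂ := mul_right_cancel h'
    refine ⟨(Con.eq c).1 (mul_right_cancel (e₁.trans e₂.symm : c.mk' x₁ * c.mk' x₃ = c.mk' x₂ * c.mk' x₃)),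
      (Con.eq c).1 (mul_left_cancel e₁).symm⟩
  have hρ : ∀ {x y : S}, leastCancelCon S x y ↔ ∀ c : Con S, IsCancelMul c.Quotient → c x y :=
    Iff.rfl
  refine le_antisymm (TwoSidedIdeal.span_le.2 ?_) fun f hf ↦ ?_
  · have key : ∀ x y, leastCancelCon S x y → emb K x - emb K y ∈ conIdeal K (leastCancelCon S) := by
      intro x y h
      refine (TwoSidedIdeal.mem_ker _).2 ?_
      rw [map_sub, sub_eq_zero]
      have : (x : (leastCancelCon S).Quotient) = y := (Con.eq _).2 h
      simp [emb, MonoidAlgebra.of_apply, this]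
    rintro f (rfl | rfl)
    · exact key _ _ (hρ.2 fun c hc ↦ (hx c hc).1)
    · exact key _ _ (hρ.2 fun c hc ↦ (hx c hc).2)
  · let φ := (realization₁ K).monoidHom
    have hφ : ∀ s, φ s ≠ 0 := by
      intro s
      obtain ⟨a, b, c, d, rfl⟩ := exists_ordered s
      simp [φ]
    -- The image of `φ` consists of nonzero elements of a domain, so its kernel congruence is
    -- cancellative. Hence K[S] → K[X₀, X₃], with kernel P₁, factors through K[S/ρ].
    have hle : leastCancelCon S ≤ Con.ker φ := by
      refine sInf_le ?_
      have hinj : Function.Injective (Con.kerLift φ) := Con.kerLift_injective φ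
      have hne : ∀ a, Con.kerLift φ a ≠ 0 := fun a ↦ by
        induction a using Con.induction_on with
        | H s => exact hφ s
      exact
        { mul_left_cancel := fun a b c h ↦ hinj (mul_left_cancel₀ (hne a) (by
            simpa only [map_mul] using congrArg (Con.kerLift φ) h))
          mul_right_cancel := fun a b c h ↦ hinj (mul_right_cancel₀ (hne a) (by
            simpa only [map_mul] using congrArg (Con.kerLift φ) h)) }
    let ψ : MonoidAlgebra K (leastCancelCon S).Quotient →ₐ[K] MvPolynomial (Fin 4) K :=
      MonoidAlgebra.lift K _ _ (Con.lift _ φ hle)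
    have hψ : (ψ : _ →+* _).comp (MonoidAlgebra.mapDomainRingHom K (leastCancelCon S).mk') =
        ((realization₁ K).algHom K : MonoidAlgebra K S →+* MvPolynomial (Fin 4) K) := by
      ext s
      · simp [ψ, IsRealization.algHom]
      · simp [ψ, IsRealization.algHom, φ]
    rw [P₁_eq_ker, IsRealization.mem_ker]
    have h0 := RingHom.congr_fun hψ f
    rw [RingHom.comp_apply, (TwoSidedIdeal.mem_ker _).1 hf, map_zero] at h0
    exact h0.symm

end SkewExample

/-! ### Classification of the minimal primes. -/

namespace SkewExample

variable {K : Type*} [Field K]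

theorem IsPrimeTwoSided.mem_or_mem_of_emb {P : TwoSidedIdeal (MonoidAlgebra K S)}
    (hP : IsPrimeTwoSided P) {a b : MonoidAlgebra K S} (h : ∀ s, a * emb K s * b ∈ P) :
    a ∈ P ∨ b ∈ P := by
  refine hP.2 a b fun r ↦ ?_
  let G : MonoidAlgebra K S →ₗ[K] MonoidAlgebra K S :=
    (LinearMap.mulRight K b).comp (LinearMap.mulLeft K a)
  exact mem_of_forall_emb_mem ((subspace P).comap G) h r

/-- This lets x₄ be cancelled modulo a prime P without it: if sx₄ = tx₄, then (s - t)ux₄ = (s -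
t)x₄v = 0 for every u, so s - t lies in P. -/
theorem exists_mul_x₄ (s : S) : ∃ t, s * x₄ = x₄ * t := by
  induction s using right_induction with
  | one => exact ⟨1, by simp⟩
  | h₁ s ih =>
    obtain ⟨t, ht⟩ := ih
    exact ⟨t * x₃, by rw [mul_assoc, ← x₄_mul_x₃, ← mul_assoc, ht, mul_assoc]⟩
  | h₂ s ih =>
    obtain ⟨t, ht⟩ := ih
    exact ⟨t * x₂, by rw [mul_assoc, ← x₄_mul_x₂, ← mul_assoc, ht, mul_assoc]⟩
  | h₃ s ih =>
    obtain ⟨t, ht⟩ := ih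
    exact ⟨t * x₁, by rw [mul_assoc, ← x₄_mul_x₁, ← mul_assoc, ht, mul_assoc]⟩
  | h₄ s ih =>
    obtain ⟨t, ht⟩ := ih
    exact ⟨t * x₄, by rw [ht, mul_assoc]⟩

/-- The letter x₃ exchanges the commuting factors x₁ and x₂. For x₄ the product becomes x₃x₂x₄ =
x₁x₃x₄, and the overlap identity applies. -/
theorem commute_x₁_mul_x₂ (s : S) : s * (x₁ * x₂) = x₁ * x₂ * s := by
  have h₁ : x₁ * (x₁ * x₂) = x₁ * x₂ * x₁ := by rw [mul_assoc, x₂_mul_x₁]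
  have h₂ : x₂ * (x₁ * x₂) = x₁ * x₂ * x₂ := by rw [← mul_assoc, x₂_mul_x₁]
  have h₃ : x₃ * (x₁ * x₂) = x₁ * x₂ * x₃ := by
    rw [← mul_assoc, x₃_mul_x₁, mul_assoc, x₃_mul_x₂, ← mul_assoc, x₂_mul_x₁]
  have h₄ : x₄ * (x₁ * x₂) = x₁ * x₂ * x₄ := by
    rw [← mul_assoc, x₄_mul_x₁, mul_assoc, x₄_mul_x₂, ← mul_assoc, x₃_mul_x₂, x₁_mul_x₃_mul_x₄]
  induction s using right_induction with
  | one => simp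
  | h₁ s ih => rw [mul_assoc, h₁, ← mul_assoc, ih, mul_assoc]
  | h₂ s ih => rw [mul_assoc, h₂, ← mul_assoc, ih, mul_assoc]
  | h₃ s ih => rw [mul_assoc, h₃, ← mul_assoc, ih, mul_assoc]
  | h₄ s ih => rw [mul_assoc, h₄, ← mul_assoc, ih, mul_assoc]

theorem exists_le_of_isPrime {P : TwoSidedIdeal (MonoidAlgebra K S)} (hP : IsPrimeTwoSided P) :
    P₁ K ≤ P ∨ P₂ K ≤ P ∨ P₃ K ≤ P ∨ P₄ K ≤ P := by
  by_cases hx₄ : emb K x₄ ∈ P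
  · exact .inr (.inl (TwoSidedIdeal.span_le.2 (by rintro _ rfl; exact hx₄)))
  let π := P.ringCon.mk'
  have hker : ∀ x, π x = 0 ↔ x ∈ P := fun x ↦ by
    rw [← TwoSidedIdeal.mem_ker, TwoSidedIdeal.ker_ringCon_mk']
  have hcancel : ∀ s t, s * x₄ = t * x₄ → π (emb K s) = π (emb K t) := by
    intro s t h
    rw [← sub_eq_zero, ← map_sub, hker]
    refine (IsPrimeTwoSided.mem_or_mem_of_emb hP fun u ↦ ?_).resolve_right hx₄
    obtain ⟨v, hv⟩ := exists_mul_x₄ u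
    rw [mul_assoc, ← emb_mul, hv, emb_mul, ← mul_assoc, sub_mul, ← emb_mul, ← emb_mul, h, sub_self,
      zero_mul]
    exact P.zero_mem
  have hrel : ∀ s t, s = t → π (emb K s) = π (emb K t) := fun s t h ↦ by rw [h]
  set y₁ := π (emb K x₁) with hy₁
  set y₂ := π (emb K x₂) with hy₂
  set y₃ := π (emb K x₃) with hy₃
  have h13 : y₁ * y₃ = y₁ * y₂ := by simpa using hcancel _ _ x₁_mul_x₃_mul_x₄
  have h23 : y₂ * y₃ = y₁ * y₂ := by simpa using hcancel _ _ x₂_mul_x₃_mul_x₄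
  have h31 : y₃ * y₁ = y₁ * y₂ := by rw [← h23]; simpa using hrel _ _ x₃_mul_x₁
  have h21 : y₂ * y₁ = y₁ * y₂ := by simpa using hrel _ _ x₂_mul_x₁
  -- As x₁x₂ is central, annihilating it modulo the prime `P` means lying in `P`, unless x₁x₂ itself
  -- does.
  have hm : ∀ f : MonoidAlgebra K S, π f * (y₁ * y₂) = 0 → f ∈ P ∨ emb K (x₁ * x₂) ∈ P := by
    intro f hf
    refine IsPrimeTwoSided.mem_or_mem_of_emb hP fun s ↦ ?_
    rw [mul_assoc, ← emb_mul, commute_x₁_mul_x₂, emb_mul, ← mul_assoc]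
    refine P.mul_mem_right _ _ ?_
    rwa [← hker, map_mul, emb_mul, map_mul]
  have hm₁₂ := hm (emb K x₁ - emb K x₂) (by
    rw [map_sub, ← hy₁, ← hy₂, sub_mul, sub_eq_zero, ← mul_assoc y₂, h21]
    calc y₁ * (y₁ * y₂) = y₁ * (y₁ * y₃) := by rw [h13]
      _ = y₁ * (y₃ * y₂) := by rw [show y₃ * y₂ = y₁ * y₃ by simpa using hrel _ _ x₃_mul_x₂]
      _ = y₁ * y₂ * y₂ := by rw [← mul_assoc, h13])
  have hm₂₃ := hm (emb K x₂ - emb K x₃) (by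
    rw [map_sub, ← hy₂, ← hy₃, sub_mul, sub_eq_zero, ← mul_assoc, ← mul_assoc, h21, h31])
  by_cases hmP : emb K (x₁ * x₂) ∈ P
  · right; right
    have hm0 : y₁ * y₂ = 0 := by simpa using (hker _).2 hmP
    -- Now x₂x₁ and x₂x₃ lie in `P`, and x₂ commutes with x₄, so x₂sb stays in `P` for every s. With
    -- b = x₁ and b = x₃ this yields P₄ or P₃.
    have hz : ∀ b : S, π (emb K (x₂ * b)) = 0 → ∀ s, emb K x₂ * emb K s * emb K b ∈ P := by
      intro b hb s
      simp only [← emb_mul]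
      induction s using left_induction with
      | one => rw [mul_one]; exact (hker _).1 hb
      | h₁ s ih =>
        have := emb_mul_mul_mem (x := x₂ * x₁) (s := 1) (t := s * b) ((hker _).1 (by simp [← hy₁, ← hy₂, h21, hm0]))
        simpa only [one_mul, mul_assoc] using this
      | h₂ s ih =>
        simpa only [mul_one, mul_assoc] using emb_mul_mul_mem ih x₂ 1
      | h₃ s ih =>
        have := emb_mul_mul_mem (x := x₂ * x₃) (s := 1) (t := s * b) ((hker _).1 (by simp [← hy₃, ← hy₂, h23, hm0]))
        simpa only [one_mul, mul_assoc] using this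
      | h₄ s ih =>
        have := emb_mul_mul_mem ih x₄ 1
        rwa [mul_one, mul_assoc x₂, ← mul_assoc, x₄_mul_x₂, mul_assoc x₂, ← mul_assoc x₄,
          ← mul_assoc x₂] at this
    by_cases hx₂ : emb K x₂ ∈ P
    · exact .inr (TwoSidedIdeal.span_le.2 (by rintro _ rfl; exact hx₂))
    · refine .inl (TwoSidedIdeal.span_le.2 ?_)
      rintro f (rfl | rfl)
      · exact (IsPrimeTwoSided.mem_or_mem_of_emb hP (hz x₁ (by simp [← hy₁, ← hy₂, h21, hm0]))).resolve_left hx₂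
      · exact (IsPrimeTwoSided.mem_or_mem_of_emb hP (hz x₃ (by simp [← hy₃, ← hy₂, h23, hm0]))).resolve_left hx₂
  · left
    refine TwoSidedIdeal.span_le.2 ?_
    rintro f (rfl | rfl)
    exacts [hm₁₂.resolve_right hmP, hm₂₃.resolve_right hmP]

-- Four K-valued points of `S`. For every ordered pair of distinct Pᵢ, one of them kills the second
-- ideal but not the first.
variable (K) in
theorem isRealization_one : IsRealization (1 : K) 1 1 1 := by constructor <;> simp
variable (K) in
theorem isRealization_single₁ : IsRealization (1 : K) 0 0 0 := by constructor <;> simp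
variable (K) in
theorem isRealization_single₂ : IsRealization (0 : K) 1 0 0 := by constructor <;> simp
variable (K) in
theorem isRealization_single₄ : IsRealization (0 : K) 0 0 1 := by constructor <;> simp

theorem IsRealization.not_le {y₁ y₂ y₃ y₄ : K} (h : IsRealization y₁ y₂ y₃ y₄)
    {s t : Set (MonoidAlgebra K S)} (ht : ∀ f ∈ t, h.algHom K f = 0) {f : MonoidAlgebra K S}
    (hf : f ∈ s) (hf0 : h.algHom K f ≠ 0) : ¬ TwoSidedIdeal.span s ≤ TwoSidedIdeal.span t :=
  fun hle ↦ hf0 (h.span_le_ker ht (hle (TwoSidedIdeal.subset_span hf)))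

variable (K) in
theorem isAntichain : IsAntichain (· ≤ ·) ({P₁ K, P₂ K, P₃ K, P₄ K} : Set (TwoSidedIdeal (MonoidAlgebra K S))) := by
  have a₁ : ∀ f ∈ ({emb K x₁ - emb K x₂, emb K x₂ - emb K x₃} : Set _),
      (isRealization_one K).algHom K f = 0 := by
    rintro f (rfl | rfl) <;> simp [IsRealization.algHom_emb]
  have b₂ : ∀ f ∈ ({emb K x₄} : Set _), (isRealization_single₁ K).algHom K f = 0 := by
    rintro f rfl; simp [IsRealization.algHom_emb]
  have b₄ : ∀ f ∈ ({emb K x₂} : Set _), (isRealization_single₁ K).algHom K f = 0 := by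
    rintro f rfl; simp [IsRealization.algHom_emb]
  have c₂ : ∀ f ∈ ({emb K x₄} : Set _), (isRealization_single₂ K).algHom K f = 0 := by
    rintro f rfl; simp [IsRealization.algHom_emb]
  have c₃ : ∀ f ∈ ({emb K x₁, emb K x₃} : Set _), (isRealization_single₂ K).algHom K f = 0 := by
    rintro f (rfl | rfl) <;> simp [IsRealization.algHom_emb]
  have d₃ : ∀ f ∈ ({emb K x₁, emb K x₃} : Set _), (isRealization_single₄ K).algHom K f = 0 := by
    rintro f (rfl | rfl) <;> simp [IsRealization.algHom_emb]
  have d₄ : ∀ f ∈ ({emb K x₂} : Set _), (isRealization_single₄ K).algHom K f = 0 := by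
    rintro f rfl; simp [IsRealization.algHom_emb]
  rintro P (rfl | rfl | rfl | rfl) Q (rfl | rfl | rfl | rfl) hne
  · exact absurd rfl hne
  · exact IsRealization.not_le _ b₂ (.inl rfl) (by simp [IsRealization.algHom_emb])
  · exact IsRealization.not_le _ c₃ (.inl rfl) (by simp [IsRealization.algHom_emb])
  · exact IsRealization.not_le _ b₄ (.inl rfl) (by simp [IsRealization.algHom_emb])
  · exact IsRealization.not_le _ a₁ rfl (by simp [IsRealization.algHom_emb])
  · exact absurd rfl hne
  · exact IsRealization.not_le _ d₃ rfl (by simp [IsRealization.algHom_emb])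
  · exact IsRealization.not_le _ d₄ rfl (by simp [IsRealization.algHom_emb])
  · exact IsRealization.not_le _ a₁ (.inl rfl) (by simp [IsRealization.algHom_emb])
  · exact IsRealization.not_le _ b₂ (.inl rfl) (by simp [IsRealization.algHom_emb])
  · exact absurd rfl hne
  · exact IsRealization.not_le _ b₄ (.inl rfl) (by simp [IsRealization.algHom_emb])
  · exact IsRealization.not_le _ a₁ rfl (by simp [IsRealization.algHom_emb])
  · exact IsRealization.not_le _ c₂ rfl (by simp [IsRealization.algHom_emb])
  · exact IsRealization.not_le _ c₃ rfl (by simp [IsRealization.algHom_emb])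
  · exact absurd rfl hne

variable (K) in
theorem minimalPrimesTwoSided_eq :
    minimalPrimesTwoSided (MonoidAlgebra K S) = {P₁ K, P₂ K, P₃ K, P₄ K} := by
  have hprime : ∀ P ∈ ({P₁ K, P₂ K, P₃ K, P₄ K} : Set (TwoSidedIdeal (MonoidAlgebra K S))),
      IsPrimeTwoSided P := by
    rintro P (rfl | rfl | rfl | rfl)
    exacts [isPrime_P₁ K, isPrime_P₂ K, isPrime_P₃ K, isPrime_P₄ K]
  have hex : ∀ Q : TwoSidedIdeal (MonoidAlgebra K S), IsPrimeTwoSided Q →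
      ∃ P ∈ ({P₁ K, P₂ K, P₃ K, P₄ K} : Set (TwoSidedIdeal (MonoidAlgebra K S))), P ≤ Q := by
    intro Q hQ
    rcases exists_le_of_isPrime hQ with h | h | h | h
    exacts [⟨_, by simp, h⟩, ⟨_, by simp, h⟩, ⟨_, by simp, h⟩, ⟨_, by simp, h⟩]
  ext P
  constructor
  · intro hP
    obtain ⟨Q, hQ, hle⟩ := hex P hP.1
    rwa [← hP.eq_of_le (hprime Q hQ) hle]
  · intro hP
    refine ⟨hprime P hP, fun Q hQ hle ↦ ?_⟩
    obtain ⟨P', hP', hle'⟩ := hex Q hQ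
    rwa [(isAntichain K).eq hP' hP (hle'.trans hle)] at hle'

end SkewExample

/-! ### The classical Krull dimension. -/

namespace SkewExample

open MvPolynomial

variable {K : Type*} [Field K]

/-! ### Central elements -/

/-- This is (T - u)(T - v)(T - w) evaluated at T = u, with v and w kept in order since they need not
commute. -/
theorem cubic_eq_zero {R : Type*} [Ring R] {u v w : R} (huv : Commute u v) (huw : Commute u w) :
    u ^ 3 - (u + v + w) * u ^ 2 + (u * v + u * w + v * w) * u - u * v * w = 0 := by
  have h₁ : v * w * u = u * v * w := by
    rw [mul_assoc, ← huw.eq, ← mul_assoc, ← huv.eq]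
  have h₂ : v * u ^ 2 = u * v * u := by rw [sq, ← mul_assoc, huv.eq]
  have h₃ : w * u ^ 2 = u * w * u := by rw [sq, ← mul_assoc, huw.eq]
  rw [add_mul, add_mul, add_mul, add_mul, h₁, h₂, h₃, ← pow_succ']
  abel

variable (K) in
theorem isRealization_emb : IsRealization (emb K x₁) (emb K x₂) (emb K x₃) (emb K x₄) := by
  constructor <;> simp only [← emb_mul, x₄_mul_x₃, x₄_mul_x₂, x₄_mul_x₁, x₃_mul_x₂, x₃_mul_x₁, x₂_mul_x₁]

section

variable {R : Type*} [Ring R] {y₁ y₂ y₃ y₄ : R}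

/-- The elementary symmetric polynomials in `y₁²`, `y₂²`, `y₃²`, followed by `y₄²`. -/
def centralElement (y₁ y₂ y₃ y₄ : R) : Fin 4 → R :=
  ![y₁ ^ 2 + y₂ ^ 2 + y₃ ^ 2, y₁ ^ 2 * y₂ ^ 2 + y₁ ^ 2 * y₃ ^ 2 + y₂ ^ 2 * y₃ ^ 2,
    y₁ ^ 2 * y₂ ^ 2 * y₃ ^ 2, y₄ ^ 2]

namespace IsRealization

variable (h : IsRealization y₁ y₂ y₃ y₄)
include h

theorem commute₂₁ : Commute y₂ y₁ := h.r21

theorem commute₁₃ : Commute y₁ (y₃ ^ 2) := by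
  rw [sq]
  exact (SemiconjBy.mul_left (show SemiconjBy y₃ y₂ y₁ from h.r32) (show SemiconjBy y₃ y₁ y₂ from h.r31)).symm

theorem commute₂₃ : Commute y₂ (y₃ ^ 2) := by
  rw [sq]
  exact (SemiconjBy.mul_left (show SemiconjBy y₃ y₁ y₂ from h.r31) (show SemiconjBy y₃ y₂ y₁ from h.r32)).symm

theorem commute_sq₁₂ : Commute (y₁ ^ 2) (y₂ ^ 2) := (h.commute₂₁.pow_pow 2 2).symm
theorem commute_sq₁₃ : Commute (y₁ ^ 2) (y₃ ^ 2) := h.commute₁₃.pow_left 2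
theorem commute_sq₂₃ : Commute (y₂ ^ 2) (y₃ ^ 2) := h.commute₂₃.pow_left 2

/-- The squares y₁², y₂², y₃² commute with one another and with y₁ and y₂. Conjugation by y₃
exchanges the first two and y₄ exchanges the first and third, so symmetric functions of them are
central. The double exchange makes y₄² central. -/
theorem commute_centralElement (i : Fin 4) :
    Commute y₁ (centralElement y₁ y₂ y₃ y₄ i) ∧ Commute y₂ (centralElement y₁ y₂ y₃ y₄ i) ∧
    Commute y₃ (centralElement y₁ y₂ y₃ y₄ i) ∧ Commute y₄ (centralElement y₁ y₂ y₃ y₄ i) := by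
  have c₁₁ : Commute y₁ (y₁ ^ 2) := Commute.self_pow y₁ 2
  have c₁₂ : Commute y₁ (y₂ ^ 2) := h.commute₂₁.symm.pow_right 2
  have c₂₁ : Commute y₂ (y₁ ^ 2) := h.commute₂₁.pow_right 2
  have c₂₂ : Commute y₂ (y₂ ^ 2) := Commute.self_pow y₂ 2
  have s₃₁ : SemiconjBy y₃ (y₁ ^ 2) (y₂ ^ 2) := SemiconjBy.pow_right h.r31 2
  have s₃₂ : SemiconjBy y₃ (y₂ ^ 2) (y₁ ^ 2) := SemiconjBy.pow_right h.r32 2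
  have s₃₃ : SemiconjBy y₃ (y₃ ^ 2) (y₃ ^ 2) := Commute.self_pow y₃ 2
  have s₄₁ : SemiconjBy y₄ (y₁ ^ 2) (y₃ ^ 2) := SemiconjBy.pow_right h.r41 2
  have s₄₂ : SemiconjBy y₄ (y₂ ^ 2) (y₂ ^ 2) := SemiconjBy.pow_right h.r42 2
  have s₄₃ : SemiconjBy y₄ (y₃ ^ 2) (y₁ ^ 2) := SemiconjBy.pow_right h.r43 2
  have e₁₂ := h.commute_sq₁₂.eq
  have e₁₃ := h.commute_sq₁₃.eq
  have e₂₃ := h.commute_sq₂₃.eq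
  have e₁₂₃ : y₂ ^ 2 * y₁ ^ 2 * y₃ ^ 2 = y₁ ^ 2 * y₂ ^ 2 * y₃ ^ 2 := by rw [e₁₂]
  have e₃₂₁ : y₃ ^ 2 * y₂ ^ 2 * y₁ ^ 2 = y₁ ^ 2 * y₂ ^ 2 * y₃ ^ 2 := by
    rw [← e₂₃, mul_assoc, ← e₁₃, ← mul_assoc, e₁₂]
  fin_cases i <;> simp only [centralElement, Fin.zero_eta, Fin.mk_one, Fin.reduceFinMk,
    Matrix.cons_val]
  · refine ⟨(c₁₁.add_right c₁₂).add_right h.commute₁₃, (c₂₁.add_right c₂₂).add_right h.commute₂₃, ?_, ?_⟩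
    · have := (s₃₁.add_right s₃₂).add_right s₃₃
      rwa [add_comm (y₂ ^ 2)] at this
    · have := (s₄₁.add_right s₄₂).add_right s₄₃
      rwa [add_comm (y₃ ^ 2), add_comm _ (y₁ ^ 2), ← add_assoc] at this
  · refine ⟨((c₁₁.mul_right c₁₂).add_right (c₁₁.mul_right h.commute₁₃)).add_right (c₁₂.mul_right h.commute₁₃),
      ((c₂₁.mul_right c₂₂).add_right (c₂₁.mul_right h.commute₂₃)).add_right (c₂₂.mul_right h.commute₂₃),
      ?_, ?_⟩
    · have := ((s₃₁.mul_right s₃₂).add_right (s₃₁.mul_right s₃₃)).add_right (s₃₂.mul_right s₃₃)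
      rw [← e₁₂, add_right_comm (y₁ ^ 2 * y₂ ^ 2) (y₂ ^ 2 * y₃ ^ 2)] at this
      exact this
    · have := ((s₄₁.mul_right s₄₂).add_right (s₄₁.mul_right s₄₃)).add_right (s₄₂.mul_right s₄₃)
      rw [← e₁₂, ← e₁₃, ← e₂₃] at this
      have e : y₂ ^ 2 * y₃ ^ 2 + y₁ ^ 2 * y₃ ^ 2 + y₁ ^ 2 * y₂ ^ 2 =
          y₁ ^ 2 * y₂ ^ 2 + y₁ ^ 2 * y₃ ^ 2 + y₂ ^ 2 * y₃ ^ 2 := by abel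
      rwa [e] at this
  · refine ⟨(c₁₁.mul_right c₁₂).mul_right h.commute₁₃, (c₂₁.mul_right c₂₂).mul_right h.commute₂₃, ?_, ?_⟩
    · have := (s₃₁.mul_right s₃₂).mul_right s₃₃
      rwa [e₁₂₃] at this
    · have := (s₄₁.mul_right s₄₂).mul_right s₄₃
      rwa [e₃₂₁] at this
  · rw [sq]
    exact ⟨(SemiconjBy.mul_left (show SemiconjBy y₄ y₃ y₁ from h.r43) (show SemiconjBy y₄ y₁ y₃ from h.r41)).symm,
      (SemiconjBy.mul_left (show SemiconjBy y₄ y₂ y₂ from h.r42) (show SemiconjBy y₄ y₂ y₂ from h.r42)).symm,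
      (SemiconjBy.mul_left (show SemiconjBy y₄ y₁ y₃ from h.r41) (show SemiconjBy y₄ y₃ y₁ from h.r43)).symm,
      (Commute.refl y₄).mul_right (Commute.refl y₄)⟩

theorem sextic_eq_zero : ∀ y ∈ ({y₁, y₂, y₃} : Set R),
    y ^ 6 - centralElement y₁ y₂ y₃ y₄ 0 * y ^ 4 + centralElement y₁ y₂ y₃ y₄ 1 * y ^ 2 -
      centralElement y₁ y₂ y₃ y₄ 2 = 0 := by
  have c₁₂ := h.commute_sq₁₂
  have c₁₃ := h.commute_sq₁₃
  have c₂₃ := h.commute_sq₂₃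
  have hp : ∀ y : R, y ^ 6 = (y ^ 2) ^ 3 ∧ y ^ 4 = (y ^ 2) ^ 2 := fun y ↦
    ⟨by rw [← pow_mul], by rw [← pow_mul]⟩
  simp only [centralElement, Matrix.cons_val]
  rintro y (rfl | rfl | rfl) <;> rw [(hp _).1, (hp _).2]
  · exact cubic_eq_zero c₁₂ c₁₃
  · have := cubic_eq_zero c₁₂.symm c₂₃
    rw [← c₁₂.eq] at this
    rwa [add_comm (y₁ ^ 2), add_right_comm (y₁ ^ 2 * y ^ 2)]
  · have := cubic_eq_zero c₁₃.symm c₂₃.symm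
    rw [← c₁₃.eq, ← c₂₃.eq, mul_assoc, c₂₃.eq.symm, ← mul_assoc] at this
    have e : y₁ ^ 2 * y ^ 2 + y₂ ^ 2 * y ^ 2 + y₁ ^ 2 * y₂ ^ 2 =
        y₁ ^ 2 * y₂ ^ 2 + y₁ ^ 2 * y ^ 2 + y₂ ^ 2 * y ^ 2 := by abel
    rwa [e, add_assoc (y ^ 2), add_comm (y ^ 2)] at this

end IsRealization

end

variable (K) in
/-- The central elements of `K[S]`. -/
noncomputable abbrev zeta : Fin 4 → MonoidAlgebra K S :=
  centralElement (emb K x₁) (emb K x₂) (emb K x₃) (emb K x₄)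

theorem zeta_mem_center (i : Fin 4) : zeta K i ∈ Subalgebra.center K (MonoidAlgebra K S) := by
  obtain ⟨h₁, h₂, h₃, h₄⟩ := (isRealization_emb K).commute_centralElement i
  rw [Subalgebra.mem_center_iff]
  intro f
  have : f ∈ Subalgebra.toSubmodule (Subalgebra.centralizer K {zeta K i}) := by
    refine mem_of_forall_emb_mem _ (fun s ↦ ?_) f
    rw [Subalgebra.mem_toSubmodule]
    have key : ∀ x, Commute (emb K x) (zeta K i) → emb K x ∈ Subalgebra.centralizer K {zeta K i} := by
      intro x hx
      rw [Subalgebra.mem_centralizer_iff]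
      rintro _ rfl
      exact hx.symm
    induction s using right_induction with
    | one => rw [emb_one]; exact one_mem _
    | h₁ s ih => rw [emb_mul]; exact mul_mem ih (key _ h₁)
    | h₂ s ih => rw [emb_mul]; exact mul_mem ih (key _ h₂)
    | h₃ s ih => rw [emb_mul]; exact mul_mem ih (key _ h₃)
    | h₄ s ih => rw [emb_mul]; exact mul_mem ih (key _ h₄)
  rw [Subalgebra.mem_toSubmodule, Subalgebra.mem_centralizer_iff] at this
  exact (this _ rfl).symm

/-- In front of x₄ all mixed words of equal length coincide: the second symmetric function becomes 3
copies of `mixed 2`, its product with the first 9 copies of `mixed 4`, and the third one `mixed 4`.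
-/
theorem zeta_relation : (zeta K 0 * zeta K 1 - 9 * zeta K 2) * zeta K 3 = 0 := by
  have hm : ∀ a b c, (¬ (b = 0 ∧ c = 0) ∧ ¬ (a = 0 ∧ c = 0) ∧ ¬ (a = 0 ∧ b = 0)) →
      emb K x₁ ^ a * emb K x₂ ^ b * emb K x₃ ^ c * emb K x₄ = emb K (mixed (a + b + c - 2)) := by
    rintro a b c ⟨h₁, h₂, h₃⟩
    rw [← (((ordered_mul_x₄ a b c).resolve_left h₁).resolve_left h₂).resolve_left h₃]
    simp
  have h12 := hm 2 2 0 (by simp)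
  have h13 := hm 2 0 2 (by simp)
  have h23 := hm 0 2 2 (by simp)
  have h123 := hm 2 2 2 (by simp)
  simp only [pow_zero, mul_one, one_mul, Nat.reduceAdd, Nat.reduceSub] at h12 h13 h23 h123
  have e₁ : emb K x₁ ^ 2 * emb K (mixed 2) = emb K (mixed 4) := by
    rw [← emb_pow, ← emb_mul, x₁_pow_mul_mixed]
  have e₂ : emb K x₂ ^ 2 * emb K (mixed 2) = emb K (mixed 4) := by
    rw [← emb_pow, ← emb_mul, x₂_pow_mul_mixed]
  have e₃ : emb K x₃ ^ 2 * emb K (mixed 2) = emb K (mixed 4) := by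
    rw [← emb_pow, ← emb_mul, sq, mul_assoc, x₃_mul_mixed, x₃_mul_mixed]
  simp only [zeta, centralElement, Matrix.cons_val]
  rw [sq (emb K x₄), ← mul_assoc, sub_mul, mul_assoc, mul_assoc 9, h123,
    add_mul _ _ (emb K x₄), add_mul _ _ (emb K x₄), h12, h13, h23]
  simp only [mul_add, add_mul, e₁, e₂, e₃]
  rw [show (9 : MonoidAlgebra K S) = 1 + 1 + 1 + 1 + 1 + 1 + 1 + 1 + 1 by norm_num]
  simp only [add_mul, one_mul]
  convert zero_mul _ using 2
  abel

/-- The letters are integral over `A`, by the sextic for x₁, x₂, x₃ and by x₄² for x₄. Ordered words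
span K[S], so it is the product of the four finitely generated modules A[xᵢ]. -/
theorem finite_of_central {A : Type*} [CommRing A] [Algebra A (MonoidAlgebra K S)]
    (a : Fin 4 → A) (ha : ∀ i, algebraMap A (MonoidAlgebra K S) (a i) = zeta K i)
    (hK : ∀ k : K, ∃ b : A, algebraMap A (MonoidAlgebra K S) b = algebraMap K _ k) :
    Module.Finite A (MonoidAlgebra K S) := by
  nontriviality A
  have hint : ∀ y ∈ ({emb K x₁, emb K x₂, emb K x₃} : Set _), IsIntegral A y := by
    intro y hy
    refine ⟨Polynomial.X ^ 6 + (-Polynomial.C (a 0) * Polynomial.X ^ 4 +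
      Polynomial.C (a 1) * Polynomial.X ^ 2 - Polynomial.C (a 2)), ?_, ?_⟩
    · exact Polynomial.monic_X_pow_add (by compute_degree!)
    · have := (isRealization_emb K).sextic_eq_zero y hy
      rw [← Polynomial.aeval_def]
      simp only [map_add, map_sub, map_mul, map_neg, map_pow, Polynomial.aeval_X, Polynomial.aeval_C, ha]
      rw [← this, neg_mul]
      abel
  have hint₄ : IsIntegral A (emb K x₄) := by
    refine ⟨Polynomial.X ^ 2 + (-Polynomial.C (a 3)), ?_, ?_⟩
    · exact Polynomial.monic_X_pow_add (by compute_degree!)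
    · rw [← Polynomial.aeval_def]
      simp only [map_add, map_neg, map_pow, Polynomial.aeval_X, Polynomial.aeval_C, ha, zeta,
        centralElement, Matrix.cons_val]
      exact add_neg_cancel _
  let N : S → Submodule A (MonoidAlgebra K S) := fun x ↦
    Subalgebra.toSubmodule (Algebra.adjoin A {emb K x})
  have hN : ∀ (x : S) (n : ℕ), emb K x ^ n ∈ N x := fun x n ↦
    pow_mem (Algebra.self_mem_adjoin_singleton A _) n
  let M := N x₁ * N x₂ * N x₃ * N x₄
  have hM : M.FG := (((hint _ (by simp)).fg_adjoin_singleton.mul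
    (hint _ (by simp)).fg_adjoin_singleton).mul (hint _ (by simp)).fg_adjoin_singleton).mul
    hint₄.fg_adjoin_singleton
  -- The image of `A` contains the scalars, so `M` is also a K-subspace, and it suffices to check
  -- that it contains the elements of `S`.
  let M' : Submodule K (MonoidAlgebra K S) :=
    { M with
      smul_mem' := fun k f hf ↦ by
        obtain ⟨b, hb⟩ := hK k
        rw [Algebra.smul_def, ← hb, ← Algebra.smul_def]
        exact M.smul_mem b hf }
  refine ⟨?_⟩
  convert hM
  refine (eq_top_iff.2 fun f _ ↦ ?_).symm
  refine mem_of_forall_emb_mem M' (fun s ↦ ?_) f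
  obtain ⟨a, b, c, d, rfl⟩ := exists_ordered s
  change _ ∈ M
  simp only [emb_mul, emb_pow]
  exact Submodule.mul_mem_mul (Submodule.mul_mem_mul (Submodule.mul_mem_mul (hN _ _) (hN _ _))
    (hN _ _)) (hN _ _)

theorem length_le_three (l : LTSeries {P : TwoSidedIdeal (MonoidAlgebra K S) // IsPrimeTwoSided P}) :
    l.length ≤ 3 := by
  let A := MvPolynomial (Fin 4) K
  let ψ : A →ₐ[K] Subalgebra.center K (MonoidAlgebra K S) :=
    aeval fun i ↦ ⟨zeta K i, zeta_mem_center i⟩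
  let f : A →+* MonoidAlgebra K S := (Subalgebra.center K (MonoidAlgebra K S)).val.toRingHom.comp ψ.toRingHom
  let _ : Algebra A (MonoidAlgebra K S) := f.toAlgebra' fun a x ↦
    ((Subalgebra.mem_center_iff.1 (ψ a).2) x).symm
  have hX : ∀ i, algebraMap A (MonoidAlgebra K S) (X i) = zeta K i := fun i ↦ by
    change ((ψ (X i) : Subalgebra.center K (MonoidAlgebra K S)) : MonoidAlgebra K S) = _
    simp only [ψ, A, aeval_X]
  have : Module.Finite A (MonoidAlgebra K S) := finite_of_central X hX fun k ↦ ⟨C k, by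
    change ((ψ (algebraMap K A k) : Subalgebra.center K (MonoidAlgebra K S)) : MonoidAlgebra K S) = _
    rw [AlgHom.commutes]; rfl⟩
  -- The value at (1, 1, 0, 1) is 1 in every characteristic.
  have hne : ((X 0 * X 1 - 9 * X 2) * X 3 : A) ≠ 0 := fun h0 ↦ by
    have := congrArg (MvPolynomial.eval ![1, 1, 0, 1]) h0
    simp at this
  have hdim := length_add_one_le_ringKrullDim (A := A) hne (by
    rw [map_mul, map_sub, map_mul, map_mul, hX, hX, hX, hX, map_ofNat]
    exact zeta_relation) l
  rw [MvPolynomial.ringKrullDim_of_isNoetherianRing, ringKrullDim_eq_zero_of_field, zero_add,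
    Nat.card_eq_fintype_card, Fintype.card_fin] at hdim
  have : l.length + 1 ≤ 4 := by exact_mod_cast hdim
  omega

/-! ### A chain of primes of length three -/

theorem IsRealization.ker_le {B B' : Type*} [Ring B] [Algebra K B] [Ring B'] [Algebra K B']
    {y₁ y₂ y₃ y₄ : B} (h : IsRealization y₁ y₂ y₃ y₄) {y₁' y₂' y₃' y₄' : B'}
    (h' : IsRealization y₁' y₂' y₃' y₄') (g : B →ₐ[K] B') (h₁ : g y₁ = y₁') (h₂ : g y₂ = y₂')
    (h₃ : g y₃ = y₃') (h₄ : g y₄ = y₄') : h.ker K ≤ h'.ker K := by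
  have : g.comp (h.algHom K) = h'.algHom K := by
    refine MonoidAlgebra.algHom_ext (fun s ↦ ?_) (by ext)
    change g (h.algHom K (emb K s)) = h'.algHom K (emb K s)
    rw [h.algHom_emb, h'.algHom_emb]
    induction s using right_induction with
    | one => simp
    | h₁ s ih => simp [ih, h₁]
    | h₂ s ih => simp [ih, h₂]
    | h₃ s ih => simp [ih, h₃]
    | h₄ s ih => simp [ih, h₄]
  intro f hf
  rw [mem_ker] at hf ⊢
  rw [← this, AlgHom.comp_apply, hf, map_zero]

variable (K) in
theorem three_le_classicalKrullDim : 3 ≤ classicalKrullDim (MonoidAlgebra K S) := by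
  -- Above P₂ the chain kills x₃, then x₁, then x₂. Each quotient above P₂ embeds in a polynomial
  -- ring, so these kernels are prime.
  have r₁ : IsRealization (X 0 : MvPolynomial (Fin 4) K) (X 1) 0 0 := by
    constructor <;> simp [mul_comm]
  have r₂ : IsRealization (0 : MvPolynomial (Fin 4) K) (X 1) 0 0 := by constructor <;> simp
  have r₃ : IsRealization (0 : MvPolynomial (Fin 4) K) 0 0 0 := by constructor <;> simp
  have l₁ : P₂ K < r₁.ker K := by
    refine lt_of_le_not_ge (TwoSidedIdeal.span_le.2 ?_) fun hle ↦ ?_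
    · rintro _ rfl
      exact IsRealization.mem_ker.2 (by simp [IsRealization.algHom_emb])
    · have : emb K x₃ ∈ P₂ K := hle (IsRealization.mem_ker.2 (by simp [IsRealization.algHom_emb]))
      rw [P₂_eq_ker, IsRealization.mem_ker, IsRealization.algHom_emb] at this
      have := congrFun (congrFun this 0) 1
      simp [swap] at this
  have l₂ : r₁.ker K < r₂.ker K := by
    refine lt_of_le_not_ge (r₁.ker_le r₂ (aeval ![0, X 1, 0, 0]) ?_ ?_ ?_ ?_) fun hle ↦ ?_
    iterate 4 simp
    have : emb K x₁ ∈ r₁.ker K := hle (IsRealization.mem_ker.2 (by simp [IsRealization.algHom_emb]))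
    rw [IsRealization.mem_ker, IsRealization.algHom_emb] at this
    simp at this
  have l₃ : r₂.ker K < r₃.ker K := by
    refine lt_of_le_not_ge (r₂.ker_le r₃ (aeval ![0, 0, 0, 0]) ?_ ?_ ?_ ?_) fun hle ↦ ?_
    iterate 4 simp
    have : emb K x₂ ∈ r₂.ker K := hle (IsRealization.mem_ker.2 (by simp [IsRealization.algHom_emb]))
    rw [IsRealization.mem_ker, IsRealization.algHom_emb] at this
    simp at this
  let l : LTSeries {P : TwoSidedIdeal (MonoidAlgebra K S) // IsPrimeTwoSided P} :=
    { length := 3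
      toFun := ![⟨P₂ K, isPrime_P₂ K⟩, ⟨r₁.ker K, isPrimeTwoSided_ker _⟩,
        ⟨r₂.ker K, isPrimeTwoSided_ker _⟩, ⟨r₃.ker K, isPrimeTwoSided_ker _⟩]
      step := fun i ↦ by
        fin_cases i
        exacts [l₁, l₂, l₃] }
  exact Order.LTSeries.length_le_krullDim l

variable (K) in
theorem classicalKrullDim_eq : classicalKrullDim (MonoidAlgebra K S) = 3 := by
  refine le_antisymm (iSup_le fun l ↦ ?_) (three_le_classicalKrullDim K)
  exact_mod_cast length_le_three l

end SkewExample

theorem mainTheorem12 (K : Type*) [Field K] :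
    minimalPrimesTwoSided (MonoidAlgebra K SkewExample.S) =
        {SkewExample.P₁ K, SkewExample.P₂ K, SkewExample.P₃ K, SkewExample.P₄ K} ∧
      SkewExample.P₁ K = conIdeal K (leastCancelCon SkewExample.S) ∧
      IsSemiprimeRing (MonoidAlgebra K SkewExample.S) ∧
      classicalKrullDim (MonoidAlgebra K SkewExample.S) = 3 ∧
      (Set.univ : Set SkewExample.S) =
        (Submonoid.closure {SkewExample.x₁, SkewExample.x₂, SkewExample.x₃} : Set SkewExample.S) ∪
        (Submonoid.powers SkewExample.x₁ : Set SkewExample.S) * Submonoid.powers SkewExample.x₄ ∪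
        (Submonoid.powers SkewExample.x₂ : Set SkewExample.S) * Submonoid.powers SkewExample.x₄ ∪
        (Submonoid.powers SkewExample.x₃ : Set SkewExample.S) * Submonoid.powers SkewExample.x₄ ∪
        (Submonoid.powers SkewExample.x₁ : Set SkewExample.S) * {SkewExample.x₂} *
          Submonoid.powers SkewExample.x₄ :=
  ⟨SkewExample.minimalPrimesTwoSided_eq K, SkewExample.P₁_eq_conIdeal K,
    SkewExample.isSemiprimeRing K, SkewExample.classicalKrullDim_eq K, SkewExample.univ_eq_union⟩
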